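/- Let $n\ge 1$ and write $\oplus$ for bitwise XOR. For $\omega\in\{0,1\}^{2n}$ let $\omega_L$ and $\omega_R$ be its first and its last $n$ bits, and let $*$ denote concatenation. For $f:\{0,1\}^n\to\{0,1\}^n$ let $\mathsf{LR}[f]$ be the permutation $\omega\mapsto \omega_R*(\omega_L\oplus f(\omega_R))$ of $\{0,1\}^{2n}$, and let $\mathsf{LR}^2[f]=\mathsf{LR}[f]\circ\mathsf{LR}[f]$. For keys $K_0,K_1,K_2\in\{0,1\}^{2n}$ and permutations $f_1,f_2$ of $\{0,1\}^n$, the 2-round BPEM cipher is the permutation of $\{0,1\}^{2n}$ given by $$\mathsf{BPEM}[K_0,K_1,K_2;f_1,f_2](m)=\mathsf{LR}^2[f_2]\bigl(\mathsf{LR}^2[f_1](m\oplus K_0)\oplus K_1\bigr)\oplus K_2 .$$ Let $K_0,K_1,K_2$ be uniform on $\{0,1\}^{2n}$, let $f_1,f_2$ be uniformly random permutations of $\{0,1\}^n$, and let $\Pi$ be a uniformly random permutation of $\{0,1\}^{2n}$, all independent. For $q_*,q_1,q_2\in\mathbb{N}$ let $\Delta^{im\text{-}sprp}_{\mathsf{BPEM}}(q_*,q_1,q_2)$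 be the maximum of $$\Bigl|\Pr\bigl[A^{(\mathsf{BPEM}[K_0,K_1,K_2;f_1,f_2],\,f_1,\,f_2)}=1\bigr]-\Pr\bigl[A^{(\Pi,\,f_1,\,f_2)}=1\bigr]\Bigr|$$ over all adaptive, possibly randomized, computationally unbounded adversaries $A$ that output one bit, may query each of the three oracles in both directions (that is, also its inverse), and make at most $q_*$, $q_1$, $q_2$ queries (both directions together) to the first, second and third oracle, respectively. Then, for all $q_*,q_1,q_2\in\mathbb{N}$, $$\Delta^{im\text{-}sprp}_{\mathsf{BPEM}}(q_*,q_1,q_2)\le\frac{q_*\,(13q_*+4q_1+4q_2)}{2^n}.$$ -/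

import Mathlib

namespace BPEM

/-- Bit strings of length `m`, i.e. `{0,1}^m`. The bits are elements of `ZMod 2`, so that the
bitwise XOR of two strings is their sum `x + y`. -/
abbrev Str (m : ℕ) : Type := Fin m → ZMod 2

variable {n : ℕ}

/-- The first `n` bits of a string of length `2n = n + n`. -/
def left (w : Str (n + n)) : Str n := fun i => w (Fin.castAdd n i)

/-- The last `n` bits of a string of length `2n = n + n`. -/
def right (w : Str (n + n)) : Str n := fun i => w (Fin.natAdd n i)

/-- Concatenation of two strings of length `n`. -/
def cat (x y : Str n) : Str (n + n) := Fin.append x y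

theorem left_cat (x y : Str n) : left (cat x y) = x :=
  funext fun i => Fin.append_left x y i

theorem right_cat (x y : Str n) : right (cat x y) = y :=
  funext fun i => Fin.append_right x y i

theorem cat_left_right (w : Str (n + n)) : cat (left w) (right w) = w :=
  Fin.append_castAdd_natAdd

theorem add_self_eq_zero {m : ℕ} (x : Str m) : x + x = 0 := by
  funext i; exact CharTwo.add_self_eq_zero (x i)

/-- The Luby-Rackoff (Feistel) permutation `w ↦ w_R * (w_L ⊕ f (w_R))` of `{0,1}^{2n}`. -/
def LR (f : Str n → Str n) : Equiv.Perm (Str (n + n)) where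
  toFun w := cat (right w) (left w + f (right w))
  invFun w := cat (right w + f (left w)) (left w)
  left_inv w := by
    simp only [left_cat, right_cat, add_assoc, add_self_eq_zero, add_zero, cat_left_right]
  right_inv w := by
    simp only [left_cat, right_cat, add_assoc, add_self_eq_zero, add_zero, cat_left_right]

/-- Two Luby-Rackoff rounds with the same round function, `LR[f, f] = LR[f] ∘ LR[f]`. -/
def LR2 (f : Str n → Str n) : Equiv.Perm (Str (n + n)) := (LR f).trans (LR f)

/-- The 2-round Even-Mansour cipher `x ↦ P₂ (P₁ (x ⊕ K₀) ⊕ K₁) ⊕ K₂`. -/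
def EM {m : ℕ} (K₀ K₁ K₂ : Str m) (P₁ P₂ : Equiv.Perm (Str m)) : Equiv.Perm (Str m) :=
  (Equiv.addRight K₀).trans <| P₁.trans <| (Equiv.addRight K₁).trans <| P₂.trans <|
    Equiv.addRight K₂

theorem EM_apply {m : ℕ} (K₀ K₁ K₂ : Str m) (P₁ P₂ : Equiv.Perm (Str m)) (x : Str m) :
    EM K₀ K₁ K₂ P₁ P₂ x = P₂ (P₁ (x + K₀) + K₁) + K₂ := rfl

/-- The 2-round balanced permutations Even-Mansour cipher `BPEM[K₀, K₁, K₂; f₁, f₂]`. -/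
def cipher (K₀ K₁ K₂ : Str (n + n)) (f₁ f₂ : Equiv.Perm (Str n)) :
    Equiv.Perm (Str (n + n)) :=
  EM K₀ K₁ K₂ (LR2 f₁) (LR2 f₂)

/-- The oracles an adversary interacts with: a permutation of `{0,1}^{2n}` (the
encryption/decryption oracle) and two public permutations of `{0,1}^n`. -/
structure Oracles (n : ℕ) where
  block : Equiv.Perm (Str (n + n))
  pub₁ : Equiv.Perm (Str n)
  pub₂ : Equiv.Perm (Str n)

/-- The direction in which a permutation is queried. -/
inductive Dir where
  | forward
  | backward

/-- The answer of a permutation oracle, which can be queried in both directions. -/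
def ask {α : Type} (π : Equiv.Perm α) : Dir → α → α
  | .forward => π
  | .backward => π.symm

/-- A deterministic, adaptive, computationally unbounded oracle adversary: either it stops with an
output bit, or it queries one of the three oracles in one of the two directions and continues
in a way that depends on the answer. -/
inductive DetAdversary (n : ℕ) : Type where
  | output (b : Bool)
  | queryBlock (d : Dir) (x : Str (n + n)) (next : Str (n + n) → DetAdversary n)
  | queryPub₁ (d : Dir) (x : Str n) (next : Str n → DetAdversary n)
  | queryPub₂ (d : Dir) (x : Str n) (next : Str n → DetAdversary n)

namespace DetAdversary

/-- The output bit of an adversary that interacts with the given oracles. -/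
def run (O : Oracles n) : DetAdversary n → Bool
  | output b => b
  | queryBlock d x next => (next (ask O.block d x)).run O
  | queryPub₁ d x next => (next (ask O.pub₁ d x)).run O
  | queryPub₂ d x next => (next (ask O.pub₂ d x)).run O

/-- `A.MakesAtMost q q₁ q₂`: whatever answers it receives, the adversary makes at most `q` queries
to the encryption/decryption oracle and at most `q₁`, `q₂` queries to the first and to the second
public permutation; both directions are counted together. -/
def MakesAtMost : DetAdversary n → ℕ → ℕ → ℕ → Prop
  | output _, _, _, _ => True
  | queryBlock _ _ next, q, q₁, q₂ => 1 ≤ q ∧ ∀ y, (next y).MakesAtMost (q - 1) q₁ q₂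
  | queryPub₁ _ _ next, q, q₁, q₂ => 1 ≤ q₁ ∧ ∀ y, (next y).MakesAtMost q (q₁ - 1) q₂
  | queryPub₂ _ _ next, q, q₁, q₂ => 1 ≤ q₂ ∧ ∀ y, (next y).MakesAtMost q q₁ (q₂ - 1)

end DetAdversary

/-- A (randomized) adversary is a probability distribution on deterministic adversaries: it draws
its coins and then plays the resulting deterministic strategy. -/
abbrev Adversary (n : ℕ) : Type := PMF (DetAdversary n)

/-- The query bounds of a randomized adversary hold for all outcomes of its coins. -/
def Adversary.MakesAtMost (A : Adversary n) (q q₁ q₂ : ℕ) : Prop :=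
  ∀ D ∈ PMF.support A, D.MakesAtMost q q₁ q₂

/-- The distribution of the output bit of an adversary that interacts with oracles drawn
(independently of the coins of the adversary) from the distribution `W`. -/
noncomputable def outputDist (A : Adversary n) (W : PMF (Oracles n)) : PMF Bool :=
  A.bind fun D => W.bind fun O => PMF.pure (D.run O)

/-- The probability that the adversary outputs `1`. -/
noncomputable def probOne (A : Adversary n) (W : PMF (Oracles n)) : ℝ :=
  (outputDist A W true).toReal

/-- The advantage of an adversary in distinguishing two distributions of oracles. -/
noncomputable def advantage (A : Adversary n) (W W' : PMF (Oracles n)) : ℝ :=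
  |probOne A W - probOne A W'|

/-- The advantages of all adversaries that respect the given query bounds. -/
def advantages (W W' : PMF (Oracles n)) (q q₁ q₂ : ℕ) : Set ℝ :=
  {δ | ∃ A : Adversary n, A.MakesAtMost q q₁ q₂ ∧ advantage A W W' = δ}

/-- The maximum advantage of all adversaries that respect the given query bounds. -/
noncomputable def maxAdvantage (W W' : PMF (Oracles n)) (q q₁ q₂ : ℕ) : ℝ :=
  sSup (advantages W W' q q₁ q₂)

theorem probOne_mem (A : Adversary n) (W : PMF (Oracles n)) :
    0 ≤ probOne A W ∧ probOne A W ≤ 1 :=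
  ⟨ENNReal.toReal_nonneg,
    ENNReal.toReal_le_of_le_ofReal zero_le_one (by simpa using PMF.coe_le_one _ true)⟩

theorem advantages_nonempty (W W' : PMF (Oracles n)) (q q₁ q₂ : ℕ) :
    (advantages W W' q q₁ q₂).Nonempty := by
  refine ⟨_, PMF.pure (.output true), fun D hD => ?_, rfl⟩
  rw [PMF.support_pure, Set.mem_singleton_iff] at hD
  subst hD
  trivial

theorem advantages_bddAbove (W W' : PMF (Oracles n)) (q q₁ q₂ : ℕ) :
    BddAbove (advantages W W' q q₁ q₂) := by
  refine ⟨1, ?_⟩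
  rintro _ ⟨A, -, rfl⟩
  have h := probOne_mem A W
  have h' := probOne_mem A W'
  exact abs_le.2 ⟨by linarith [h.1, h'.2], by linarith [h.2, h'.1]⟩

/-- The real oracles: `(BPEM[K₀, K₁, K₂; f₁, f₂], f₁, f₂)` with independent and uniformly
distributed keys `K₀, K₁, K₂` and permutations `f₁, f₂`. -/
noncomputable def realWorld (n : ℕ) : PMF (Oracles n) :=
  (PMF.uniformOfFintype (Str (n + n))).bind fun K₀ =>
  (PMF.uniformOfFintype (Str (n + n))).bind fun K₁ =>
  (PMF.uniformOfFintype (Str (n + n))).bind fun K₂ =>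
  (PMF.uniformOfFintype (Equiv.Perm (Str n))).bind fun f₁ =>
  (PMF.uniformOfFintype (Equiv.Perm (Str n))).bind fun f₂ =>
  PMF.pure ⟨cipher K₀ K₁ K₂ f₁ f₂, f₁, f₂⟩

/-- The ideal oracles: `(π, f₁, f₂)` with independent and uniformly distributed permutations `π`
of `{0,1}^{2n}` and `f₁, f₂` of `{0,1}^n`. -/
noncomputable def idealWorld (n : ℕ) : PMF (Oracles n) :=
  (PMF.uniformOfFintype (Equiv.Perm (Str (n + n)))).bind fun π =>
  (PMF.uniformOfFintype (Equiv.Perm (Str n))).bind fun f₁ =>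
  (PMF.uniformOfFintype (Equiv.Perm (Str n))).bind fun f₂ =>
  PMF.pure ⟨π, f₁, f₂⟩

/-- The SPRP-advantage in the ideal model of the 2-round BPEM cipher on blocks of `2n` bits. -/
noncomputable def imSprpAdvantage (n q q₁ q₂ : ℕ) : ℝ :=
  maxAdvantage (realWorld n) (idealWorld n) q q₁ q₂

end BPEM

/-! The proof is an H-coefficient argument. A transcript consists of block pairs `M` and public
pairs `Q`, `Q'`; put N = 2^n.

Write K₀ = l∗k, K₁ = d∗d', K₂ = k'∗l' and, for a block pair, m = b∗a, c = a'∗b'. Evaluating the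
cipher from both ends, the "first calls" f(a+k) and f'(a'+k') yield the midpoints s = b+l+f(a+k) and
t = b'+l'+f'(a'+k'). Then m encrypts to c as soon as the "second calls" satisfy f(s) = a+k+d'+t and
f'(t) = a'+k'+d+s (`cipher_apply_eq`). If inputs and prescribed outputs of the second calls are
distinct and avoid the public queries and the first calls, each of these 2·#M equations costs at
most a factor N (`card_not_collides_le`). So the real world gives the block pairs a weight of about
N^(-2·#M), which the ideal world exceeds only by a Bernoulli-type factor.

Most collisions are unlikely because, given everything else, they determine one key half. When two
second calls on the same side collide, l and d cancel and the randomness of f takes over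
(`card_collides_le`). It fails only if a is the same for both pairs; the collision is then visible
in the transcript, and `ClashFree` excludes it. In the ideal world each answer clashes with
probability O(q/N) (`card_clash_record_le`).

Induction over the decision tree (`prob_consistent_run_le`) combines both estimates into a one-sided
bound for each output bit; applied to both bits it bounds the advantage. -/

namespace BPEM

open Finset

/-! ### Counting permutations with prescribed values -/

section Extensions

variable {α : Type*} [Fintype α] [DecidableEq α]

/-- The permutations that map `p.1` to `p.2` for all pairs `p ∈ S`. -/
noncomputable def extensions (S : Finset (α × α)) : Finset (Equiv.Perm α) :=
  {f | ∀ p ∈ S, f p.1 = p.2}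

theorem mem_extensions {S : Finset (α × α)} {f : Equiv.Perm α} :
    f ∈ extensions S ↔ ∀ p ∈ S, f p.1 = p.2 := by
  simp [extensions]

theorem mem_extensions_insert {S : Finset (α × α)} {p : α × α} {f : Equiv.Perm α} :
    f ∈ extensions (insert p S) ↔ f ∈ extensions S ∧ f p.1 = p.2 := by
  simp only [mem_extensions, forall_mem_insert, and_comm]

theorem extensions_empty : extensions (∅ : Finset (α × α)) = univ := by
  ext f; simp [mem_extensions]

theorem sum_card_extensions_insert (S : Finset (α × α)) (a : α) :
    ∑ b, #(extensions (insert (a, b) S)) = #(extensions S) := by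
  rw [card_eq_sum_card_fiberwise (f := fun f : Equiv.Perm α => f a) (t := univ)
    (fun _ _ => mem_coe.2 (mem_univ _))]
  refine sum_congr rfl fun b _ => congrArg _ ?_
  ext f
  simp [mem_extensions_insert]

theorem apply_notMem_range {S : Finset (α × α)} {a : α} (ha : ∀ p ∈ S, p.1 ≠ a)
    {f : Equiv.Perm α} (hf : f ∈ extensions S) : ∀ p ∈ S, p.2 ≠ f a := fun p hp h =>
  ha p hp (f.injective ((mem_extensions.1 hf p hp).trans h))

/-- Composing with the transposition of `b` and `c` is injective. It respects `S`: as `a` is outside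
the domain of `S`, the value `b` of `f` at `a` is not prescribed elsewhere. Hence unused values are
the most likely ones, which yields both the lower bound 1/N and the upper bound 1/(N - #S) for a
single value. -/
theorem card_extensions_insert_le {S : Finset (α × α)} {a b c : α}
    (ha : ∀ p ∈ S, p.1 ≠ a) (hc : ∀ p ∈ S, p.2 ≠ c) :
    #(extensions (insert (a, b) S)) ≤ #(extensions (insert (a, c) S)) := by
  refine card_le_card_of_injOn (fun f => f.trans (Equiv.swap b c)) (fun f hf => ?_)
    (fun f _ g _ h => ?_)
  · obtain ⟨hf, hb⟩ := mem_extensions_insert.1 (mem_coe.1 hf)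
    refine mem_coe.2 (mem_extensions_insert.2 ⟨mem_extensions.2 fun p hp => ?_, ?_⟩)
    · have h := apply_notMem_range ha hf p hp
      rw [hb] at h
      rw [Equiv.trans_apply, mem_extensions.1 hf p hp,
        Equiv.swap_apply_of_ne_of_ne h (hc p hp)]
    · simp only at hb
      rw [Equiv.trans_apply, hb, Equiv.swap_apply_left]
  · exact Equiv.ext fun x => (Equiv.swap b c).injective (Equiv.congr_fun h x)

theorem card_extensions_le {S : Finset (α × α)} {a c : α}
    (ha : ∀ p ∈ S, p.1 ≠ a) (hc : ∀ p ∈ S, p.2 ≠ c) :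
    #(extensions S) ≤ Fintype.card α * #(extensions (insert (a, c) S)) := by
  rw [← sum_card_extensions_insert S a]
  exact (sum_le_card_nsmul _ _ _ fun b _ => card_extensions_insert_le ha hc).trans
    (by simp)

theorem extensions_insert_eq_empty_of_left {S : Finset (α × α)} {a b c : α}
    (h : (a, c) ∈ S) (hbc : c ≠ b) : extensions (insert (a, b) S) = ∅ := by
  refine eq_empty_of_forall_notMem fun f hf => hbc ?_
  rw [mem_extensions_insert] at hf
  exact (mem_extensions.1 hf.1 _ h).symm.trans hf.2

theorem extensions_insert_eq_empty_of_right {S : Finset (α × α)} {a b c : α}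
    (h : (c, b) ∈ S) (hac : c ≠ a) : extensions (insert (a, b) S) = ∅ := by
  refine eq_empty_of_forall_notMem fun f hf => hac ?_
  rw [mem_extensions_insert] at hf
  exact f.injective ((mem_extensions.1 hf.1 _ h).trans hf.2.symm)

theorem mul_card_extensions_insert_le_of_left {S : Finset (α × α)} {a b : α}
    (ha : ∀ p ∈ S, p.1 ≠ a) :
    (Fintype.card α - #S) * #(extensions (insert (a, b) S)) ≤ #(extensions S) := by
  have hcard : Fintype.card α - #S ≤ #(univ \ S.image Prod.snd) := by
    rw [card_sdiff_of_subset (subset_univ _), card_univ]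
    exact Nat.sub_le_sub_left card_image_le _
  calc _ ≤ #(univ \ S.image Prod.snd) * #(extensions (insert (a, b) S)) :=
        Nat.mul_le_mul_right _ hcard
    _ = ∑ _c ∈ univ \ S.image Prod.snd, #(extensions (insert (a, b) S)) := by simp
    _ ≤ ∑ c ∈ univ \ S.image Prod.snd, #(extensions (insert (a, c) S)) := by
        refine sum_le_sum fun c hc => card_extensions_insert_le ha fun p hp h => ?_
        exact (mem_sdiff.1 hc).2 (mem_image.2 ⟨p, hp, h⟩)
    _ ≤ ∑ c, #(extensions (insert (a, c) S)) :=
        sum_le_sum_of_subset (subset_univ _)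
    _ = _ := sum_card_extensions_insert S a

theorem mul_card_extensions_insert_le_of_right {S : Finset (α × α)} {a b : α}
    (hb : ∀ p ∈ S, p.2 ≠ b) :
    (Fintype.card α - #S) * #(extensions (insert (a, b) S)) ≤ #(extensions S) := by
  by_cases ha : ∀ p ∈ S, p.1 ≠ a
  · exact mul_card_extensions_insert_le_of_left ha
  · push Not at ha
    obtain ⟨⟨a', c⟩, hp, rfl⟩ := ha
    rw [extensions_insert_eq_empty_of_left hp (hb _ hp)]
    simp

/-- The constant `c` in place of `#S` keeps the base of the power fixed during the induction. -/
theorem pow_mul_card_extensions_le (S : Finset (α × α)) (c : ℕ) (hc : #S ≤ c) :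
    (Fintype.card α - c) ^ #S * #(extensions S) ≤ Fintype.card (Equiv.Perm α) := by
  induction S using Finset.induction_on with
  | empty => simp [extensions_empty]
  | insert p S hp ih =>
    rw [card_insert_of_notMem hp] at hc ⊢
    have ih := ih (by omega)
    by_cases ha : ∀ p' ∈ S, p'.1 ≠ p.1
    · have h := mul_card_extensions_insert_le_of_left (b := p.2) ha
      calc _ = (Fintype.card α - c) ^ #S *
            ((Fintype.card α - c) * #(extensions (insert p S))) := by ring
        _ ≤ (Fintype.card α - c) ^ #S * #(extensions S) :=
            Nat.mul_le_mul_left _ (le_trans (Nat.mul_le_mul_right _ (by omega)) h)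
        _ ≤ _ := ih
    · push Not at ha
      obtain ⟨p', hp', h⟩ := ha
      have h0 := extensions_insert_eq_empty_of_left (a := p.1) (b := p.2) (c := p'.2) (S := S)
        (by rw [← h]; exact hp') (fun h2 => hp (by rwa [← Prod.ext h h2]))
      have h0' : extensions (insert p S) = ∅ := h0
      rw [h0']
      simp

/-- The pairs `(s i, z i)` are added one at a time. Distinctness keeps each new pair off the domain
and range fixed so far, so each costs at most a factor N. -/
theorem card_extensions_le_pow_mul {ι : Type*} {S : Finset (α × α)} (M : Finset ι) (s z : ι → α)
    (hs : ∀ i ∈ M, ∀ j ∈ M, s i = s j → i = j) (hz : ∀ i ∈ M, ∀ j ∈ M, z i = z j → i = j)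
    (hsS : ∀ i ∈ M, ∀ p ∈ S, p.1 ≠ s i) (hzS : ∀ i ∈ M, ∀ p ∈ S, p.2 ≠ z i)
    (P : Equiv.Perm α → Prop) [DecidablePred P] (hP : ∀ f, (∀ i ∈ M, f (s i) = z i) → P f) :
    #(extensions S) ≤ Fintype.card α ^ #M * #{f ∈ extensions S | P f} := by
  classical
  have key : #(extensions S) ≤
      Fintype.card α ^ #M * #(extensions (S ∪ M.image fun i => (s i, z i))) := by
    clear hP
    induction M using Finset.induction_on with
    | empty => simp
    | insert i M hi ih =>
      have ih := ih (fun i hi j hj => hs i (mem_insert_of_mem hi) j (mem_insert_of_mem hj))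
        (fun i hi j hj => hz i (mem_insert_of_mem hi) j (mem_insert_of_mem hj))
        (fun i hi => hsS i (mem_insert_of_mem hi)) (fun i hi => hzS i (mem_insert_of_mem hi))
      rw [card_insert_of_notMem hi, image_insert, union_insert, pow_succ, mul_assoc]
      refine ih.trans (Nat.mul_le_mul_left _ (card_extensions_le ?_ ?_))
      · intro p hp h
        rcases mem_union.1 hp with hp | hp
        · exact hsS i (mem_insert_self _ _) p hp h
        · obtain ⟨j, hj, rfl⟩ := mem_image.1 hp
          exact hi (hs j (mem_insert_of_mem hj) i (mem_insert_self _ _) h ▸ hj)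
      · intro p hp h
        rcases mem_union.1 hp with hp | hp
        · exact hzS i (mem_insert_self _ _) p hp h
        · obtain ⟨j, hj, rfl⟩ := mem_image.1 hp
          exact hi (hz j (mem_insert_of_mem hj) i (mem_insert_self _ _) h ▸ hj)
  refine key.trans (Nat.mul_le_mul_left _ (card_le_card fun f hf => ?_))
  rw [mem_extensions] at hf
  exact mem_filter.2 ⟨mem_extensions.2 fun p hp => hf p (mem_union_left _ hp),
    hP f fun i hi => hf _ (mem_union_right _ (mem_image_of_mem _ hi))⟩

/-- Once the value at `b` is fixed, the value at `a` is forced, while `a` is still free. Only `a`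
has to avoid `S`; `b` may be a recorded query. -/
theorem mul_card_extensions_add_eq_le [AddCommGroup α] {S : Finset (α × α)} {a b : α} (hab : a ≠ b)
    (ha : ∀ p ∈ S, p.1 ≠ a) (d : α)
    [DecidablePred fun f : Equiv.Perm α => f a + f b = d] :
    (Fintype.card α - (#S + 1)) * #{f ∈ extensions S | f a + f b = d} ≤ #(extensions S) := by
  rw [← sum_card_extensions_insert S b, card_eq_sum_card_fiberwise
    (f := fun f : Equiv.Perm α => f b) (t := univ) (fun _ _ => mem_coe.2 (mem_univ _)), mul_sum]
  refine sum_le_sum fun y _ => ?_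
  have h := mul_card_extensions_insert_le_of_left (S := insert (b, y) S) (a := a) (b := d - y) (by
    intro p hp h
    rcases mem_insert.1 hp with rfl | hp
    · exact hab h.symm
    · exact ha p hp h)
  refine le_trans (Nat.mul_le_mul ?_ (card_le_card fun f hf => ?_)) h
  · have := card_insert_le (b, y) S
    omega
  · simp only [mem_filter] at hf
    obtain ⟨⟨hf, h1⟩, rfl⟩ := hf
    exact mem_extensions_insert.2 ⟨mem_extensions_insert.2 ⟨hf, rfl⟩, eq_sub_of_add_eq h1⟩

end Extensions

/-! ### Union bounds over key halves -/

section Classical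

open scoped Classical

theorem card_filter_exists_le {ι β : Type*} (A : Finset β) (M : Finset ι) (P : ι → β → Prop) (c : ℕ)
    [∀ i, DecidablePred (P i)] [DecidablePred fun v => ∃ i ∈ M, P i v]
    (h : ∀ i ∈ M, #{v ∈ A | P i v} ≤ c) : #{v ∈ A | ∃ i ∈ M, P i v} ≤ #M * c := by
  refine (card_le_card fun v hv => ?_).trans (card_biUnion_le_card_mul M (fun i => {v ∈ A | P i v}) c h)
  obtain ⟨hv, i, hi, hP⟩ := mem_filter.1 hv
  exact mem_biUnion.2 ⟨i, hi, mem_filter.2 ⟨hv, hP⟩⟩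

theorem card_filter_or_le {β : Type*} (A : Finset β) (P P' : β → Prop) (c c' : ℕ)
    [DecidablePred P] [DecidablePred P'] [DecidablePred fun v => P v ∨ P' v]
    (h : #{v ∈ A | P v} ≤ c) (h' : #{v ∈ A | P' v} ≤ c') : #{v ∈ A | P v ∨ P' v} ≤ c + c' := by
  refine le_trans (card_le_card fun v hv => ?_) ((card_union_le _ _).trans (add_le_add h h'))
  rw [mem_union, mem_filter, mem_filter, ← and_or_left]
  exact mem_filter.1 hv

theorem card_filter_le_add {β : Type*} (A : Finset β) (P P₁ P₂ : β → Prop) [DecidablePred P]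
    [DecidablePred P₁] [DecidablePred P₂] (h : ∀ v, P v → P₁ v ∨ P₂ v) :
    #{v ∈ A | P v} ≤ #{v ∈ A | P₁ v} + #{v ∈ A | P₂ v} :=
  (card_le_card (monotone_filter_right _ fun v _ => h v)).trans
    (card_filter_or_le _ _ _ _ _ le_rfl le_rfl)

/-- An event that leaves at most one value of one key half, given all the rest, has probability at
most 1/N. The two variants below treat the other key halves. -/
theorem card_filter_determines_le₁ {G B : Type*} [Fintype G] (E : Finset B) (P : (G × G × G) × B → Prop)
    [DecidablePred P]
    (h : ∀ k k' l m f, P ((k, l, m), f) → P ((k', l, m), f) → k = k') :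
    #{v ∈ (univ : Finset (G × G × G)) ×ˢ E | P v} ≤ Fintype.card G ^ 2 * #E := by
  refine (card_le_card_of_injOn (t := (univ : Finset (G × G)) ×ˢ E) (fun v => (v.1.2, v.2))
    ?_ ?_).trans (by simp [card_product, sq])
  · intro v hv
    simp only [coe_filter, mem_product, Set.mem_ofPred_eq] at hv
    simp [hv.1.2]
  · rintro ⟨⟨k, l, m⟩, f⟩ hv ⟨⟨k', l', m'⟩, f'⟩ hv' heq
    simp only [coe_filter, mem_product, Set.mem_ofPred_eq] at hv hv'
    simp only [Prod.mk.injEq] at heq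
    obtain ⟨⟨rfl, rfl⟩, rfl⟩ := heq
    rw [h _ _ _ _ _ hv.2 hv'.2]

theorem card_filter_determines_le₂ {G B : Type*} [Fintype G] (E : Finset B) (P : (G × G × G) × B → Prop)
    [DecidablePred P]
    (h : ∀ k l l' m f, P ((k, l, m), f) → P ((k, l', m), f) → l = l') :
    #{v ∈ (univ : Finset (G × G × G)) ×ˢ E | P v} ≤ Fintype.card G ^ 2 * #E := by
  refine (card_le_card_of_injOn (t := (univ : Finset (G × G)) ×ˢ E)
    (fun v => ((v.1.1, v.1.2.2), v.2)) ?_ ?_).trans (by simp [card_product, sq])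
  · intro v hv
    simp only [coe_filter, mem_product, Set.mem_ofPred_eq] at hv
    simp [hv.1.2]
  · rintro ⟨⟨k, l, m⟩, f⟩ hv ⟨⟨k', l', m'⟩, f'⟩ hv' heq
    simp only [coe_filter, mem_product, Set.mem_ofPred_eq] at hv hv'
    simp only [Prod.mk.injEq] at heq
    obtain ⟨⟨rfl, rfl⟩, rfl⟩ := heq
    rw [h _ _ _ _ _ hv.2 hv'.2]

theorem card_filter_determines_le₃ {G B : Type*} [Fintype G] (E : Finset B) (P : (G × G × G) × B → Prop)
    [DecidablePred P]
    (h : ∀ k l m m' f, P ((k, l, m), f) → P ((k, l, m'), f) → m = m') :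
    #{v ∈ (univ : Finset (G × G × G)) ×ˢ E | P v} ≤ Fintype.card G ^ 2 * #E := by
  refine (card_le_card_of_injOn (t := (univ : Finset (G × G)) ×ˢ E)
    (fun v => ((v.1.1, v.1.2.1), v.2)) ?_ ?_).trans (by simp [card_product, sq])
  · intro v hv
    simp only [coe_filter, mem_product, Set.mem_ofPred_eq] at hv
    simp [hv.1.2]
  · rintro ⟨⟨k, l, m⟩, f⟩ hv ⟨⟨k', l', m'⟩, f'⟩ hv' heq
    simp only [coe_filter, mem_product, Set.mem_ofPred_eq] at hv hv'
    simp only [Prod.mk.injEq] at heq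
    obtain ⟨⟨rfl, rfl⟩, rfl⟩ := heq
    rw [h _ _ _ _ _ hv.2 hv'.2]

theorem add_eq_of_add_eq_add {G : Type*} [AddCommGroup G] (hG : ∀ x : G, x + x = 0) {x y z w : G} (h : x + y = z + w) :
    y + w = x + z := by
  have hneg : ∀ x : G, -x = x := fun x => neg_eq_of_add_eq_zero_left (hG x)
  have : y = -x + (z + w) := by rw [← h]; abel
  rw [this, hneg]
  calc _ = x + z + (w + w) := by abel
    _ = _ := by rw [hG, add_zero]

/-! ### Collisions on one side of the cipher -/

section Side

variable {G ι : Type*} [AddCommGroup G] [Fintype G] [DecidableEq G]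

/-- The input `s = b + l + f (a + k)` of the second call of the round function `f`. -/
def second (k l : G) (f : G → G) (a b : G) : G := b + l + f (a + k)

/-- The event, for one of the two Feistel permutations, that an input or an output of the calls of
`f` collides with a public query in `Q`, `Q'` or with an input or output of another call. Here
`v = ((k, l, h), f)` consists of two outer key halves, a middle key half and the permutation. -/
def Collides (M : Finset ι) (a b a' : ι → G) (Q Q' : Finset (G × G)) (k' : G) (f' : Equiv.Perm G)
    (v : (G × G × G) × Equiv.Perm G) : Prop :=
  ∃ i ∈ M,
    (∃ p ∈ Q, p.1 = a i + v.1.1) ∨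
    (∃ p ∈ Q, p.1 = second v.1.1 v.1.2.1 v.2 (a i) (b i)) ∨
    (∃ p ∈ Q', p.2 = a' i + k' + v.1.2.2 + second v.1.1 v.1.2.1 v.2 (a i) (b i)) ∨
    (∃ j ∈ M, a j + v.1.1 = second v.1.1 v.1.2.1 v.2 (a i) (b i)) ∨
    (∃ j ∈ M, f' (a' j + k') = a' i + k' + v.1.2.2 + second v.1.1 v.1.2.1 v.2 (a i) (b i)) ∨
    (∃ j ∈ M, i ≠ j ∧ (∀ p ∈ Q, p.1 ≠ a i + v.1.1) ∧
      (second v.1.1 v.1.2.1 v.2 (a i) (b i) = second v.1.1 v.1.2.1 v.2 (a j) (b j) ∨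
        a' i + k' + second v.1.1 v.1.2.1 v.2 (a i) (b i) =
          a' j + k' + second v.1.1 v.1.2.1 v.2 (a j) (b j)))

theorem card_filter_add_eq_le {Q : Finset (G × G)} (hQ : 4 * (#Q + 1) ≤ Fintype.card G) {a b : G}
    (hab : a ≠ b) (d : G) :
    3 * #{v ∈ (univ : Finset (G × G × G)) ×ˢ extensions Q | (∀ p ∈ Q, p.1 ≠ a + v.1.1) ∧
      v.2 (a + v.1.1) + v.2 (b + v.1.1) = d} ≤ 4 * (Fintype.card G ^ 2 * #(extensions Q)) := by
  set N := Fintype.card G with hN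
  have h : ∀ u : G × G × G, 3 * N * #{f ∈ extensions Q | (∀ p ∈ Q, p.1 ≠ a + u.1) ∧
      f (a + u.1) + f (b + u.1) = d} ≤ 4 * #(extensions Q) := by
    intro u
    by_cases hu : ∀ p ∈ Q, p.1 ≠ a + u.1
    · have := mul_card_extensions_add_eq_le (a := a + u.1) (b := b + u.1)
        (fun h => hab (add_right_cancel h)) hu d
      -- The hypothesis `hQ` gives N - (#Q + 1) ≥ 3N/4, the source of the factor 4/3.
      calc _ ≤ 4 * (N - (#Q + 1)) * #{f ∈ extensions Q | f (a + u.1) + f (b + u.1) = d} :=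
            Nat.mul_le_mul (by omega) (card_le_card fun f hf => by
              simp only [mem_filter] at hf ⊢; exact ⟨hf.1, hf.2.2⟩)
        _ ≤ 4 * #(extensions Q) := by rw [mul_assoc]; exact Nat.mul_le_mul_left _ this
    · rw [filter_eq_empty_iff.2 fun f _ h => hu h.1]
      simp
  have hpos : 0 < N := by omega
  refine Nat.le_of_mul_le_mul_left ?_ hpos
  rw [card_filter, sum_product]
  simp only [← card_filter]
  calc _ = ∑ u : G × G × G, 3 * N * #{f ∈ extensions Q | (∀ p ∈ Q, p.1 ≠ a + u.1) ∧
      f (a + u.1) + f (b + u.1) = d} := by rw [← mul_sum]; ring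
    _ ≤ ∑ u : G × G × G, 4 * #(extensions Q) := sum_le_sum fun u _ => h u
    _ = _ := by
      simp only [sum_const, card_univ, Fintype.card_prod, ← hN, smul_eq_mul]; ring

/-- If `a i = a j`, the values of `f` cancel and `hb` rules out both equations. Otherwise each
equation prescribes the sum of two values of `f` and has probability at most 4/(3N). -/
theorem card_second_eq_le (hG : ∀ x : G, x + x = 0) {a b a' : ι → G} {Q : Finset (G × G)} (k' : G)
    (hQ : 4 * (#Q + 1) ≤ Fintype.card G) {i j : ι}
    (hb : a i = a j → b i ≠ b j ∧ b i + b j ≠ a' i + a' j) :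
    3 * #{v ∈ (univ : Finset (G × G × G)) ×ˢ extensions Q | (∀ p ∈ Q, p.1 ≠ a i + v.1.1) ∧
      (second v.1.1 v.1.2.1 v.2 (a i) (b i) = second v.1.1 v.1.2.1 v.2 (a j) (b j) ∨
        a' i + k' + second v.1.1 v.1.2.1 v.2 (a i) (b i) =
          a' j + k' + second v.1.1 v.1.2.1 v.2 (a j) (b j))} ≤
      8 * (Fintype.card G ^ 2 * #(extensions Q)) := by
  have hc : ∀ {x y z w : G}, x + y = z + w → y + w = x + z := add_eq_of_add_eq_add hG
  by_cases haij : a i = a j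
  · obtain ⟨h1, h2⟩ := hb haij
    rw [filter_eq_empty_iff.2]
    · simp
    · rintro v - ⟨-, h | h⟩
      · rw [second, second, haij] at h
        exact h1 (add_right_cancel (add_right_cancel h))
      · rw [second, second, haij] at h
        refine h2 (hc (x := a' i) (z := a' j) ?_)
        refine add_right_cancel (b := k' + (v.1.2.1 + v.2 (a j + v.1.1))) ?_
        convert h using 1 <;> abel
  · have h1 := card_filter_add_eq_le hQ haij (b i + b j)
    have h2 := card_filter_add_eq_le hQ haij (a' i + b i + (a' j + b j))
    have h4 := card_filter_le_add ((univ : Finset (G × G × G)) ×ˢ extensions Q) (fun v => (∀ p ∈ Q, p.1 ≠ a i + v.1.1) ∧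
        (second v.1.1 v.1.2.1 v.2 (a i) (b i) = second v.1.1 v.1.2.1 v.2 (a j) (b j) ∨
          a' i + k' + second v.1.1 v.1.2.1 v.2 (a i) (b i) =
            a' j + k' + second v.1.1 v.1.2.1 v.2 (a j) (b j)))
      (fun v => (∀ p ∈ Q, p.1 ≠ a i + v.1.1) ∧
        v.2 (a i + v.1.1) + v.2 (a j + v.1.1) = b i + b j)
      (fun v => (∀ p ∈ Q, p.1 ≠ a i + v.1.1) ∧
        v.2 (a i + v.1.1) + v.2 (a j + v.1.1) = a' i + b i + (a' j + b j)) ?_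
    · generalize Fintype.card G ^ 2 * #(extensions Q) = F at h1 h2 ⊢
      linarith
    rintro v ⟨hp, h⟩
    refine h.imp (fun h => ⟨hp, ?_⟩) (fun h => ⟨hp, ?_⟩)
    · refine hc (add_right_cancel (b := v.1.2.1) ?_)
      rw [second, second] at h
      convert h using 1 <;> abel
    · refine hc (add_right_cancel (b := v.1.2.1 + k') ?_)
      rw [second, second] at h
      convert h using 1 <;> abel

/-- Clauses one to five of `Collides` fix k, l, d, l, d respectively and contribute 2·#Q + #Q' +
2·#M in units of 1/N per pair; the last contributes 8/3·#M. Everything is multiplied by 3. The size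
condition on `Q` is tied to `M.Nonempty` because without block queries the number of public queries
is not limited. -/
theorem card_collides_le (hG : ∀ x : G, x + x = 0) (M : Finset ι) (a b a' : ι → G)
    (Q Q' : Finset (G × G)) (k' : G) (f' : Equiv.Perm G)
    (hQ : M.Nonempty → 4 * (#Q + 1) ≤ Fintype.card G)
    (hb : ∀ i ∈ M, ∀ j ∈ M, i ≠ j → a i = a j → b i ≠ b j ∧ b i + b j ≠ a' i + a' j) :
    3 * #{v ∈ (univ : Finset (G × G × G)) ×ˢ extensions Q | Collides M a b a' Q Q' k' f' v} ≤
      #M * (6 * #Q + 3 * #Q' + 14 * #M) * (Fintype.card G ^ 2 * #(extensions Q)) := by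
  have hlast : ∀ i ∈ M, ∀ j ∈ M,
      #{v ∈ (univ : Finset (G × G × G)) ×ˢ extensions Q | i ≠ j ∧ (∀ p ∈ Q, p.1 ≠ a i + v.1.1) ∧
      (second v.1.1 v.1.2.1 v.2 (a i) (b i) = second v.1.1 v.1.2.1 v.2 (a j) (b j) ∨
        a' i + k' + second v.1.1 v.1.2.1 v.2 (a i) (b i) =
          a' j + k' + second v.1.1 v.1.2.1 v.2 (a j) (b j))} ≤
        8 * (Fintype.card G ^ 2 * #(extensions Q)) / 3 := by
    intro i hi j hj
    by_cases hij : i = j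
    · simp [hij]
    · simp only [ne_eq, hij, not_false_eq_true, true_and]
      rw [Nat.le_div_iff_mul_le three_pos, mul_comm]
      exact card_second_eq_le hG k' (hQ ⟨i, hi⟩) (hb i hi j hj hij)
  set F := Fintype.card G ^ 2 * #(extensions Q) with hF
  set A := (univ : Finset (G × G × G)) ×ˢ extensions Q with hA
  have e₁ : ∀ i, #{v ∈ A | ∃ p ∈ Q, p.1 = a i + v.1.1} ≤ #Q * F := fun i =>
    card_filter_exists_le A Q (fun p v => p.1 = a i + v.1.1) F fun p _ =>
      card_filter_determines_le₁ (extensions Q) _ fun k k' l m f h h' =>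
        add_left_cancel (h.symm.trans h')
  have e₂ : ∀ i, #{v ∈ A | ∃ p ∈ Q, p.1 = second v.1.1 v.1.2.1 v.2 (a i) (b i)} ≤ #Q * F :=
    fun i => card_filter_exists_le A Q
      (fun p v => p.1 = second v.1.1 v.1.2.1 v.2 (a i) (b i)) F fun p _ =>
        card_filter_determines_le₂ (extensions Q) _ fun k l l' m f h h' =>
          add_left_cancel (add_right_cancel (h.symm.trans h'))
  have e₃ : ∀ i, #{v ∈ A | ∃ p ∈ Q',
      p.2 = a' i + k' + v.1.2.2 + second v.1.1 v.1.2.1 v.2 (a i) (b i)} ≤ #Q' * F :=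
    fun i => card_filter_exists_le A Q'
      (fun p v => p.2 = a' i + k' + v.1.2.2 + second v.1.1 v.1.2.1 v.2 (a i) (b i)) F fun p _ =>
        card_filter_determines_le₃ (extensions Q) _ fun k l m m' f h h' =>
          add_left_cancel (add_right_cancel (h.symm.trans h'))
  have e₄ : ∀ i, #{v ∈ A | ∃ j ∈ M,
      a j + v.1.1 = second v.1.1 v.1.2.1 v.2 (a i) (b i)} ≤ #M * F :=
    fun i => card_filter_exists_le A M
      (fun j v => a j + v.1.1 = second v.1.1 v.1.2.1 v.2 (a i) (b i)) F fun j _ =>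
        card_filter_determines_le₂ (extensions Q) _ fun k l l' m f h h' =>
          add_left_cancel (add_right_cancel (h.symm.trans h'))
  have e₅ : ∀ i, #{v ∈ A | ∃ j ∈ M, f' (a' j + k') =
      a' i + k' + v.1.2.2 + second v.1.1 v.1.2.1 v.2 (a i) (b i)} ≤ #M * F :=
    fun i => card_filter_exists_le A M (fun j v => f' (a' j + k') =
      a' i + k' + v.1.2.2 + second v.1.1 v.1.2.1 v.2 (a i) (b i)) F fun j _ =>
        card_filter_determines_le₃ (extensions Q) _ fun k l m m' f h h' =>
          add_left_cancel (add_right_cancel (h.symm.trans h'))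
  have hmain :=
    card_filter_exists_le A M _ _ fun i (hi : i ∈ M) =>
      card_filter_or_le _ _ _ _ _ (e₁ i) <| card_filter_or_le _ _ _ _ _ (e₂ i) <|
      card_filter_or_le _ _ _ _ _ (e₃ i) <| card_filter_or_le _ _ _ _ _ (e₄ i) <|
      card_filter_or_le _ _ _ _ _ (e₅ i) <| card_filter_exists_le _ M _ _ (hlast i hi)
  have h8 : 3 * (8 * F / 3) ≤ 8 * F := Nat.mul_div_le _ _
  have hcol : #{v ∈ A | Collides M a b a' Q Q' k' f' v} ≤
      #M * (#Q * F + (#Q * F + (#Q' * F + (#M * F + (#M * F + #M * (8 * F / 3)))))) := by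
    refine le_trans (card_le_card fun v hv => ?_) hmain
    obtain ⟨h, h'⟩ := mem_filter.1 hv
    exact mem_filter.2 ⟨h, h'⟩
  calc 3 * #{v ∈ A | Collides M a b a' Q Q' k' f' v}
    _ ≤ 3 * (#M * (#Q * F + (#Q * F + (#Q' * F + (#M * F + (#M * F + #M * (8 * F / 3))))))) :=
        Nat.mul_le_mul_left 3 hcol
    _ = #M * (6 * #Q * F + 3 * #Q' * F + 6 * #M * F + #M * (3 * (8 * F / 3))) := by ring
    _ ≤ #M * (6 * #Q * F + 3 * #Q' * F + 6 * #M * F + #M * (8 * F)) := by gcongr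
    _ = #M * (6 * #Q + 3 * #Q' + 14 * #M) * F := by ring

end Side

/-! ### Resampling the second calls -/

section Solve

variable {G ι : Type*} [AddCommGroup G] [DecidableEq G]

/-- The queries `Q` together with the first calls of the round function `f`. -/
noncomputable def pinned (M : Finset ι) (a : ι → G) (Q : Finset (G × G)) (k : G)
    (f : Equiv.Perm G) : Finset (G × G) :=
  Q ∪ M.image fun i => (a i + k, f (a i + k))

theorem mem_extensions_pinned [Fintype G] {M : Finset ι} {a : ι → G} {Q : Finset (G × G)} {k : G}
    {f g : Equiv.Perm G} :
    g ∈ extensions (pinned M a Q k f) ↔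
      g ∈ extensions Q ∧ ∀ i ∈ M, g (a i + k) = f (a i + k) := by
  simp only [mem_extensions, pinned, mem_union, mem_image]
  refine ⟨fun h => ⟨fun p hp => h p (.inl hp), fun i hi => h _ (.inr ⟨i, hi, rfl⟩)⟩, ?_⟩
  rintro ⟨h, h'⟩ p (hp | ⟨i, hi, rfl⟩)
  exacts [h p hp, h' i hi]

theorem pinned_congr {M : Finset ι} {a : ι → G} (Q : Finset (G × G)) {k : G}
    {f g : Equiv.Perm G} (h : ∀ i ∈ M, g (a i + k) = f (a i + k)) :
    pinned M a Q k g = pinned M a Q k f := by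
  rw [pinned, pinned]
  congr 1
  exact image_congr fun i hi => by simp only [h i hi]

/-- The round function `f` maps the input of its second call to the value prescribed by the
other Feistel permutation. -/
def Links (M : Finset ι) (a b a' b' : ι → G) (u u' : G × G × G) (f f' g : Equiv.Perm G) :
    Prop :=
  ∀ i ∈ M, g (second u.1 u.2.1 f (a i) (b i)) =
    a i + u.1 + u'.2.2 + second u'.1 u'.2.1 f' (a' i) (b' i)

/-- Absence of collisions on the side of `f` makes the inputs of its second calls new and distinct;
absence on the side of `f'` does the same for their prescribed outputs. Hence both hypotheses are
needed. -/
theorem card_extensions_pinned_le [Fintype G] {M : Finset ι} {a b a' b' : ι → G} {Q Q' : Finset (G × G)}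
    {u u' : G × G × G} {f f' : Equiv.Perm G}
    (h : ¬ Collides M a b a' Q Q' u'.1 f' (u, f)) (h' : ¬ Collides M a' b' a Q' Q u.1 f (u', f')) :
    #(extensions (pinned M a Q u.1 f)) ≤ Fintype.card G ^ #M *
      #{g ∈ extensions (pinned M a Q u.1 f) | Links M a b a' b' u u' f f' g} := by
  simp only [Collides, not_exists, not_and, not_or] at h h'
  refine card_extensions_le_pow_mul M (fun i => second u.1 u.2.1 f (a i) (b i))
    (fun i => a i + u.1 + u'.2.2 + second u'.1 u'.2.1 f' (a' i) (b' i)) ?_ ?_ ?_ ?_ _ fun g h => h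
  · intro i hi j hj hij
    by_contra hne
    exact ((h i hi).2.2.2.2.2 j hj hne fun p hp => (h i hi).1 p hp).1 hij
  · intro i hi j hj hij
    by_contra hne
    refine ((h' i hi).2.2.2.2.2 j hj hne fun p hp => (h' i hi).1 p hp).2 ?_
    refine add_right_cancel (b := u'.2.2) ?_
    convert hij using 1 <;> abel
  · intro i hi p hp
    rcases mem_union.1 hp with hp | hp
    · exact (h i hi).2.1 p hp
    · obtain ⟨j, hj, rfl⟩ := mem_image.1 hp
      exact (h i hi).2.2.2.1 j hj
  · intro i hi p hp
    rcases mem_union.1 hp with hp | hp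
    · exact (h' i hi).2.2.1 p hp
    · obtain ⟨j, hj, rfl⟩ := mem_image.1 hp
      exact (h' i hi).2.2.2.2.1 j hj

theorem card_not_collides_le [Fintype G] (M : Finset ι) (a b a' b' : ι → G) (Q Q' : Finset (G × G))
    (u u' : G × G × G) :
    #{w ∈ extensions Q ×ˢ extensions Q' | ¬ Collides M a b a' Q Q' u'.1 w.2 (u, w.1) ∧
        ¬ Collides M a' b' a Q' Q u.1 w.1 (u', w.2)} ≤
      Fintype.card G ^ (2 * #M) * #{w ∈ extensions Q ×ˢ extensions Q' |
        Links M a b a' b' u u' w.1 w.2 w.1 ∧ Links M a' b' a b u' u w.2 w.1 w.2} := by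
  set E := extensions Q ×ˢ extensions Q' with hE
  set A := {w ∈ E | ¬ Collides M a b a' Q Q' u'.1 w.2 (u, w.1) ∧
        ¬ Collides M a' b' a Q' Q u.1 w.1 (u', w.2)} with hA
  set B := {w ∈ E | Links M a b a' b' u u' w.1 w.2 w.1 ∧
    Links M a' b' a b u' u w.2 w.1 w.2} with hB
  -- Pairs of permutations are grouped by their values at the first calls. These determine all
  -- midpoints, so within a class the linking equations have constant inputs and targets and the two
  -- permutations can be resampled independently.
  let cls : Equiv.Perm G × Equiv.Perm G → Finset (G × G) × Finset (G × G) :=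
    fun w => (pinned M a Q u.1 w.1, pinned M a' Q' u'.1 w.2)
  have hfib : ∀ t ∈ A.image cls,
      #{w ∈ A | cls w = t} ≤ Fintype.card G ^ (2 * #M) * #{w ∈ B | cls w = t} := by
    intro t ht
    obtain ⟨w₀, hw₀, rfl⟩ := mem_image.1 ht
    obtain ⟨-, h, h'⟩ := mem_filter.1 hw₀
    have h₁ := card_extensions_pinned_le (u := u) (f := w₀.1) h h'
    have h₂ := card_extensions_pinned_le (u := u') (f := w₀.2) h' h
    have hsub₁ : {w ∈ A | cls w = cls w₀} ⊆ extensions (pinned M a Q u.1 w₀.1) ×ˢ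
        extensions (pinned M a' Q' u'.1 w₀.2) := by
      intro w hw
      obtain ⟨hw, hc⟩ := mem_filter.1 hw
      obtain ⟨hw1, hw2⟩ := mem_product.1 (mem_filter.1 hw).1
      obtain ⟨hc1, hc2⟩ := Prod.mk.inj hc
      rw [← hc1, ← hc2]
      exact mem_product.2 ⟨mem_extensions_pinned.2 ⟨hw1, fun _ _ => rfl⟩,
        mem_extensions_pinned.2 ⟨hw2, fun _ _ => rfl⟩⟩
    have hsub₂ : {g ∈ extensions (pinned M a Q u.1 w₀.1) | Links M a b a' b' u u' w₀.1 w₀.2 g} ×ˢ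
        {g ∈ extensions (pinned M a' Q' u'.1 w₀.2) | Links M a' b' a b u' u w₀.2 w₀.1 g} ⊆
        {w ∈ B | cls w = cls w₀} := by
      rintro ⟨g, g'⟩ hg
      obtain ⟨hg, hg'⟩ := mem_product.1 hg
      obtain ⟨hg, hl⟩ := mem_filter.1 hg
      obtain ⟨hg', hl'⟩ := mem_filter.1 hg'
      obtain ⟨hgQ, hgf⟩ := mem_extensions_pinned.1 hg
      obtain ⟨hgQ', hgf'⟩ := mem_extensions_pinned.1 hg'
      simp only at hgQ hgQ' hgf hgf' hl hl'
      have hs : ∀ i ∈ M, second u.1 u.2.1 g (a i) (b i) = second u.1 u.2.1 w₀.1 (a i) (b i) :=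
        fun i hi => by rw [second, second, hgf i hi]
      have hs' : ∀ i ∈ M, second u'.1 u'.2.1 g' (a' i) (b' i) =
          second u'.1 u'.2.1 w₀.2 (a' i) (b' i) :=
        fun i hi => by rw [second, second, hgf' i hi]
      refine mem_filter.2 ⟨mem_filter.2 ⟨mem_product.2 ⟨hgQ, hgQ'⟩, fun i hi => ?_,
        fun i hi => ?_⟩, Prod.ext (pinned_congr Q hgf) (pinned_congr Q' hgf')⟩
      · simp only [hs i hi, hs' i hi]; exact hl i hi
      · simp only [hs i hi, hs' i hi]; exact hl' i hi
    calc _ ≤ _ := card_le_card hsub₁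
      _ ≤ _ := (card_product _ _).trans_le (Nat.mul_le_mul h₁ h₂)
      _ = Fintype.card G ^ (2 * #M) * #({g ∈ extensions (pinned M a Q u.1 w₀.1) |
          Links M a b a' b' u u' w₀.1 w₀.2 g} ×ˢ
          {g ∈ extensions (pinned M a' Q' u'.1 w₀.2) | Links M a' b' a b u' u w₀.2 w₀.1 g}) := by
        rw [card_product]; ring
      _ ≤ _ := Nat.mul_le_mul_left _ (card_le_card hsub₂)
  rw [card_eq_sum_card_image cls A]
  refine (sum_le_sum hfib).trans ?_
  rw [← mul_sum]
  refine Nat.mul_le_mul_left _ ?_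
  rw [← card_biUnion]
  · exact card_le_card (biUnion_subset.2 fun t _ => filter_subset _ _)
  · intro t _ t' _ hne
    exact disjoint_filter.2 fun w _ h h' => hne (h.symm.trans h')

end Solve

/-! ### Counting real samples consistent with a transcript -/

variable {n : ℕ}

/-- Two plaintext-ciphertext pairs for which the second calls of a round function of the cipher
cannot have different results. -/
def Clash (p p' : Str (n + n) × Str (n + n)) : Prop :=
  (left p.2 = left p'.2 ∧ right p.2 + right p'.2 = right p.1 + right p'.1) ∨
    (right p.1 = right p'.1 ∧ left p.1 + left p'.1 = left p.2 + left p'.2)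

/-- No two different pairs clash. -/
def ClashFree (M : Finset (Str (n + n) × Str (n + n))) : Prop :=
  ∀ p ∈ M, ∀ p' ∈ M, p ≠ p' → ¬ Clash p p'

theorem left_add (x y : Str (n + n)) : left (x + y) = left x + left y := rfl

theorem right_add (x y : Str (n + n)) : right (x + y) = right x + right y := rfl

theorem ext_left_right {x y : Str (n + n)} (h : left x = left y) (h' : right x = right y) :
    x = y := by
  rw [← cat_left_right x, h, h', cat_left_right]

theorem LR2_apply (f : Str n → Str n) (w : Str (n + n)) :
    LR2 f w = cat (left w + f (right w)) (right w + f (left w + f (right w))) := by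
  change cat (right (cat _ _)) (left (cat _ _) + f (right (cat _ _))) = _
  simp only [left_cat, right_cat]

theorem add_add_cancel_right {m : ℕ} (x y : Str m) : x + y + y = x := by
  rw [add_assoc, add_self_eq_zero, add_zero]

/-- The two equations glue the evaluation from the plaintext to that from the ciphertext. The
triples are `u` = (k, l, d) and `u'` = (k', l', d'): swapping sides exchanges left and right halves,
which makes the description symmetric. -/
theorem cipher_apply_eq {u u' : Str n × Str n × Str n} {f f' : Equiv.Perm (Str n)}
    {m c : Str (n + n)}
    (h : f (second u.1 u.2.1 f (right m) (left m)) =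
      right m + u.1 + u'.2.2 + second u'.1 u'.2.1 f' (left c) (right c))
    (h' : f' (second u'.1 u'.2.1 f' (left c) (right c)) =
      left c + u'.1 + u.2.2 + second u.1 u.2.1 f (right m) (left m)) :
    cipher (cat u.2.1 u.1) (cat u.2.2 u'.2.2) (cat u'.1 u'.2.1) f f' m = c := by
  have h1 : LR2 f (m + cat u.2.1 u.1) = cat (second u.1 u.2.1 f (right m) (left m))
      (u'.2.2 + second u'.1 u'.2.1 f' (left c) (right c)) := by
    rw [LR2_apply, left_add, right_add, left_cat, right_cat]
    have : left m + u.2.1 + f (right m + u.1) = second u.1 u.2.1 f (right m) (left m) := rfl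
    rw [this, h]
    congr 1
    rw [add_assoc (right m + u.1), ← add_assoc (right m + u.1), add_self_eq_zero, zero_add]
  rw [cipher, EM_apply, h1, LR2_apply]
  simp only [left_add, right_add, left_cat, right_cat]
  have h2 : u'.2.2 + second u'.1 u'.2.1 f' (left c) (right c) + u'.2.2 =
      second u'.1 u'.2.1 f' (left c) (right c) := by
    rw [add_right_comm, add_self_eq_zero, zero_add]
  have h3 : second u.1 u.2.1 f (right m) (left m) + u.2.2 +
      (left c + u'.1 + u.2.2 + second u.1 u.2.1 f (right m) (left m)) = left c + u'.1 := by
    calc _ = left c + u'.1 + (second u.1 u.2.1 f (right m) (left m) +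
          second u.1 u.2.1 f (right m) (left m)) + (u.2.2 + u.2.2) := by abel
      _ = _ := by rw [add_self_eq_zero, add_self_eq_zero, add_zero, add_zero]
  rw [h2, h', h3]
  refine ext_left_right ?_ ?_
  · rw [left_add, left_cat, left_cat, add_add_cancel_right]
  · rw [right_add, right_cat, right_cat, second]
    calc _ = right c + (u'.2.1 + u'.2.1) + (f' (left c + u'.1) + f' (left c + u'.1)) := by abel
      _ = _ := by rw [add_self_eq_zero, add_self_eq_zero, add_zero, add_zero]

/-- The keys and public permutations of the real oracles. -/
abbrev RealSample (n : ℕ) : Type :=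
  Str (n + n) × Str (n + n) × Str (n + n) × Equiv.Perm (Str n) × Equiv.Perm (Str n)

/-- The independent permutations of the ideal oracles. -/
abbrev IdealSample (n : ℕ) : Type :=
  Equiv.Perm (Str (n + n)) × Equiv.Perm (Str n) × Equiv.Perm (Str n)

/-- The real oracles for given keys and public permutations. -/
def realOracles (ω : RealSample n) : Oracles n :=
  ⟨cipher ω.1 ω.2.1 ω.2.2.1 ω.2.2.2.1 ω.2.2.2.2, ω.2.2.2.1, ω.2.2.2.2⟩

/-- The ideal oracles for given permutations. -/
def idealOracles (ω : IdealSample n) : Oracles n := ⟨ω.1, ω.2.1, ω.2.2⟩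

/-- The oracles answer the queries `M`, `Q`, `Q'` as recorded. -/
def Consistent (M : Finset (Str (n + n) × Str (n + n))) (Q Q' : Finset (Str n × Str n))
    (O : Oracles n) : Prop :=
  O.block ∈ extensions M ∧ O.pub₁ ∈ extensions Q ∧ O.pub₂ ∈ extensions Q'

theorem card_links_le (M : Finset (Str (n + n) × Str (n + n))) (Q Q' : Finset (Str n × Str n)) :
    ∑ u : Str n × Str n × Str n, ∑ u' : Str n × Str n × Str n,
      #{w ∈ extensions Q ×ˢ extensions Q' |
        Links M (fun p => right p.1) (fun p => left p.1) (fun p => left p.2) (fun p => right p.2)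
          u u' w.1 w.2 w.1 ∧
        Links M (fun p => left p.2) (fun p => right p.2) (fun p => right p.1) (fun p => left p.1)
          u' u w.2 w.1 w.2} ≤
      #{ω : RealSample n | Consistent M Q Q' (realOracles ω)} := by
  simp only [card_filter]
  rw [← sum_product' univ univ, ← sum_product' (univ ×ˢ univ) (extensions Q ×ˢ extensions Q'),
    ← card_filter, ← card_filter]
  refine card_le_card_of_injOn (fun x => (cat x.1.1.2.1 x.1.1.1, cat x.1.1.2.2 x.1.2.2.2,
    cat x.1.2.1 x.1.2.2.1, x.2.1, x.2.2)) (fun x hx => ?_) (fun x _ y _ h => ?_)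
  · obtain ⟨hx, h, h'⟩ := mem_filter.1 (mem_coe.1 hx)
    obtain ⟨hf, hf'⟩ := mem_product.1 (mem_product.1 hx).2
    refine mem_coe.2 (mem_filter.2 ⟨mem_univ _, mem_extensions.2 fun p hp => ?_, hf, hf'⟩)
    exact cipher_apply_eq (h p hp) (h' p hp)
  · obtain ⟨⟨⟨k, l, d⟩, k', l', d'⟩, f, f'⟩ := x
    obtain ⟨⟨⟨k₂, l₂, d₂⟩, k₂', l₂', d₂'⟩, f₂, f₂'⟩ := y
    have hcat : ∀ {x y x' y' : Str n}, cat x y = cat x' y' → x = x' ∧ y = y' :=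
      fun {x y x' y'} h => ⟨by rw [← left_cat x y, h, left_cat], by rw [← right_cat x y, h, right_cat]⟩
    simp only [Prod.mk.injEq] at h
    obtain ⟨h1, h2, h3, rfl, rfl⟩ := h
    obtain ⟨rfl, rfl⟩ := hcat h1
    obtain ⟨rfl, rfl⟩ := hcat h2
    obtain ⟨rfl, rfl⟩ := hcat h3
    rfl

theorem card_real_consistent_ge {M : Finset (Str (n + n) × Str (n + n))}
    {Q Q' : Finset (Str n × Str n)} (hM : ClashFree M) (hne : (extensions M).Nonempty)
    (hQ : M.Nonempty → 4 * (#Q + 1) ≤ Fintype.card (Str n))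
    (hQ' : M.Nonempty → 4 * (#Q' + 1) ≤ Fintype.card (Str n)) :
    3 * Fintype.card (Str n) ^ 6 * (#(extensions Q) * #(extensions Q')) ≤
      3 * (Fintype.card (Str n) ^ (2 * #M) *
        #{ω : RealSample n | Consistent M Q Q' (realOracles ω)}) +
      Fintype.card (Str n) ^ 5 * (#(extensions Q) * #(extensions Q')) *
        (#M * (9 * #Q + 9 * #Q' + 28 * #M)) := by
  obtain ⟨π, hπ⟩ := hne
  set N := Fintype.card (Str n) with hN
  set a : Str (n + n) × Str (n + n) → Str n := fun p => right p.1 with ha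
  set b : Str (n + n) × Str (n + n) → Str n := fun p => left p.1 with hb
  set a' : Str (n + n) × Str (n + n) → Str n := fun p => left p.2 with ha'
  set b' : Str (n + n) × Str (n + n) → Str n := fun p => right p.2 with hb'
  have h₁ := fun (k' : Str n) f' => card_collides_le (add_self_eq_zero (m := n)) M a b a' Q Q' k' f'
    hQ fun i hi j hj hij h => ⟨fun h' => hij ?_, fun h' => hM i hi j hj hij (.inr ⟨h, h'⟩)⟩
  swap
  -- Equal halves give equal plaintexts; since some permutation extends `M`, the ciphertexts agree
  -- as well.
  · have := ext_left_right h' h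
    refine Prod.ext this ?_
    rw [← mem_extensions.1 hπ i hi, ← mem_extensions.1 hπ j hj, this]
  have h₂ := fun (k : Str n) f => card_collides_le (add_self_eq_zero (m := n)) M a' b' a Q' Q k f
    hQ' fun i hi j hj hij h => ⟨fun h' => hij ?_, fun h' => hM i hi j hj hij (.inl ⟨h, h'⟩)⟩
  swap
  · have := ext_left_right h h'
    refine Prod.ext (π.injective ?_) this
    rw [mem_extensions.1 hπ i hi, mem_extensions.1 hπ j hj, this]
  let T := ((univ : Finset (Str n × Str n × Str n)) ×ˢ extensions Q) ×ˢ
    ((univ : Finset (Str n × Str n × Str n)) ×ˢ extensions Q')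
  have hT : #T = N ^ 6 * (#(extensions Q) * #(extensions Q')) := by
    simp only [T, card_product, card_univ, Fintype.card_prod, ← hN]; ring
  let P₁ : ((Str n × Str n × Str n) × Equiv.Perm (Str n)) ×
    ((Str n × Str n × Str n) × Equiv.Perm (Str n)) → Prop :=
      fun x => Collides M a b a' Q Q' x.2.1.1 x.2.2 x.1
  let P₂ : ((Str n × Str n × Str n) × Equiv.Perm (Str n)) ×
    ((Str n × Str n × Str n) × Equiv.Perm (Str n)) → Prop :=
      fun x => Collides M a' b' a Q' Q x.1.1.1 x.1.2 x.2
  have hP₁ : 3 * #{x ∈ T | P₁ x} ≤ N ^ 3 * #(extensions Q') *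
      (#M * (6 * #Q + 3 * #Q' + 14 * #M) * (N ^ 2 * #(extensions Q))) := by
    rw [card_filter, sum_product_right, mul_sum]
    simp only [← card_filter]
    refine (sum_le_card_nsmul _ _ _ fun v' _ => h₁ v'.1.1 v'.2).trans (le_of_eq ?_)
    simp only [card_product, card_univ, Fintype.card_prod, ← hN, smul_eq_mul]; ring
  have hP₂ : 3 * #{x ∈ T | P₂ x} ≤ N ^ 3 * #(extensions Q) *
      (#M * (6 * #Q' + 3 * #Q + 14 * #M) * (N ^ 2 * #(extensions Q'))) := by
    rw [card_filter, sum_product, mul_sum]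
    simp only [← card_filter]
    refine (sum_le_card_nsmul _ _ _ fun v _ => h₂ v.1.1 v.2).trans (le_of_eq ?_)
    simp only [card_product, card_univ, Fintype.card_prod, ← hN, smul_eq_mul]; ring
  have hgood : #{x ∈ T | ¬ P₁ x ∧ ¬ P₂ x} ≤ N ^ (2 * #M) *
      #{ω : RealSample n | Consistent M Q Q' (realOracles ω)} := by
    refine le_trans ?_ (Nat.mul_le_mul_left _ (card_links_le M Q Q'))
    simp only [mul_sum]
    refine le_trans (le_of_eq ?_)
      (sum_le_sum fun u _ => sum_le_sum fun u' _ => card_not_collides_le M a b a' b' Q Q' u u')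
    simp only [card_filter, T, sum_product]
    refine sum_congr rfl fun u _ => ?_
    rw [sum_comm]
  have hsplit : #T ≤ #{x ∈ T | ¬ P₁ x ∧ ¬ P₂ x} + (#{x ∈ T | P₁ x} + #{x ∈ T | P₂ x}) := by
    rw [← card_filter_add_card_filter_not (s := T) (fun x => ¬ P₁ x ∧ ¬ P₂ x)]
    refine Nat.add_le_add_left (card_filter_le_add _ _ _ _ fun x hx => ?_) _
    tauto
  calc _ = 3 * #T := by rw [hT]; ring
    _ ≤ 3 * #{x ∈ T | ¬ P₁ x ∧ ¬ P₂ x} + (3 * #{x ∈ T | P₁ x} + 3 * #{x ∈ T | P₂ x}) := by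
      linarith
    _ ≤ _ := add_le_add (Nat.mul_le_mul_left 3 hgood) (add_le_add hP₁ hP₂)
    _ = _ := by ring

/-! ### Real versus ideal probability of a clash-free transcript -/

/-- The probability of an event for a uniformly distributed sample. -/
noncomputable def prob {Ω : Type*} [Fintype Ω] (E : Ω → Prop) : ℝ :=
  (#{ω | E ω} : ℝ) / Fintype.card Ω

theorem prob_nonneg {Ω : Type*} [Fintype Ω] (E : Ω → Prop) : 0 ≤ prob E := by
  unfold prob; positivity

theorem prob_mono {Ω : Type*} [Fintype Ω] {E E' : Ω → Prop} (h : ∀ ω, E ω → E' ω) :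
    prob E ≤ prob E' := by
  unfold prob
  gcongr
  exact h _

theorem sum_prob_and_eq {Ω β : Type*} [Fintype Ω] [Fintype β] (E : Ω → Prop) (g : Ω → β) :
    ∑ y, prob (fun ω => E ω ∧ g ω = y) = prob E := by
  unfold prob
  rw [← sum_div, ← Nat.cast_sum, card_eq_sum_card_fiberwise (f := g) (t := univ)
    (fun _ _ => mem_coe.2 (mem_univ _))]
  simp only [filter_filter]

theorem card_str_add : Fintype.card (Str (n + n)) = Fintype.card (Str n) ^ 2 := by
  simp only [Fintype.card_fun, ZMod.card, Fintype.card_fin]; ring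

theorem prob_ideal_consistent (M : Finset (Str (n + n) × Str (n + n)))
    (Q Q' : Finset (Str n × Str n)) :
    prob (fun ω : IdealSample n => Consistent M Q Q' (idealOracles ω)) =
      #(extensions M) / Fintype.card (Equiv.Perm (Str (n + n))) *
        (#(extensions Q) * #(extensions Q') / Fintype.card (Equiv.Perm (Str n)) ^ 2) := by
  have : ({ω | Consistent M Q Q' (idealOracles ω)} : Finset (IdealSample n)) =
      extensions M ×ˢ extensions Q ×ˢ extensions Q' := by
    ext ω
    rw [mem_filter, mem_product, mem_product]
    exact and_iff_right (mem_univ _)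
  rw [prob, this]
  simp only [card_product, Fintype.card_prod, Nat.cast_mul]
  rw [div_mul_div_comm]
  congr 1
  ring

theorem prob_ideal_consistent_le {M : Finset (Str (n + n) × Str (n + n))}
    {Q Q' : Finset (Str n × Str n)} (hM : ClashFree M)
    (hcard : #M ≤ Fintype.card (Str n) ^ 2)
    (hQ : M.Nonempty → 4 * (#Q + 1) ≤ Fintype.card (Str n))
    (hQ' : M.Nonempty → 4 * (#Q' + 1) ≤ Fintype.card (Str n)) :
    (1 - (#M * (3 * #Q + 3 * #Q' + 28 / 3 * #M) / Fintype.card (Str n) +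
        #M ^ 2 / (Fintype.card (Str n)) ^ 2)) *
        prob (fun ω : IdealSample n => Consistent M Q Q' (idealOracles ω)) ≤
      prob (fun ω : RealSample n => Consistent M Q Q' (realOracles ω)) := by
  have hI := prob_nonneg (fun ω : IdealSample n => Consistent M Q Q' (idealOracles ω))
  have hR := prob_nonneg (fun ω : RealSample n => Consistent M Q Q' (realOracles ω))
  rcases (extensions M).eq_empty_or_nonempty with h0 | hne
  · rw [prob_ideal_consistent M, h0]
    simpa using hR
  have h1 := card_real_consistent_ge hM hne hQ hQ'
  have h2 := pow_mul_card_extensions_le M (#M) le_rfl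
  rw [card_str_add] at h2
  rw [prob_ideal_consistent] at hI ⊢
  have hR' : prob (fun ω : RealSample n => Consistent M Q Q' (realOracles ω)) =
      #{ω : RealSample n | Consistent M Q Q' (realOracles ω)} /
        ((Fintype.card (Str n) : ℝ) ^ 6 * Fintype.card (Equiv.Perm (Str n)) ^ 2) := by
    rw [prob]
    congr 1
    simp only [Fintype.card_prod, card_str_add, Nat.cast_mul, Nat.cast_pow]
    ring
  rw [hR'] at hR ⊢
  have hN : 0 < (Fintype.card (Str n) : ℝ) := by exact_mod_cast Fintype.card_pos
  have hp : 0 < (Fintype.card (Equiv.Perm (Str n)) : ℝ) := by exact_mod_cast Fintype.card_pos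
  have hP : 0 < (Fintype.card (Equiv.Perm (Str (n + n))) : ℝ) := by
    exact_mod_cast Fintype.card_pos
  have hcard' : (#M : ℝ) ≤ (Fintype.card (Str n) : ℝ) ^ 2 := by exact_mod_cast hcard
  rify [hcard] at h1 h2
  generalize (#{ω : RealSample n | Consistent M Q Q' (realOracles ω)} : ℝ) = R at *
  generalize (Fintype.card (Str n) : ℝ) = N at *
  generalize (Fintype.card (Equiv.Perm (Str n)) : ℝ) = p at *
  generalize (Fintype.card (Equiv.Perm (Str (n + n))) : ℝ) = P at *
  generalize (#(extensions M) : ℝ) = e at *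
  have hF : (0 : ℝ) ≤ #(extensions Q) * #(extensions Q') := by positivity
  generalize (#(extensions Q) : ℝ) * #(extensions Q') = F at *
  have hε : 0 ≤ (#M : ℝ) * (3 * #Q + 3 * #Q' + 28 / 3 * #M) / N := by positivity
  have hδ : 0 ≤ (#M : ℝ) ^ 2 / N ^ 2 := by positivity
  -- Bernoulli's inequality: the price of sampling without replacement in the ideal permutation.
  have hbern : N ^ (2 * #M) * (1 - (#M : ℝ) ^ 2 / N ^ 2) ≤ (N ^ 2 - #M) ^ #M := by
    have hle : (#M : ℝ) / N ^ 2 ≤ 1 := by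
      rwa [div_le_one (by positivity)]
    have := one_add_mul_le_pow (a := -((#M : ℝ) / N ^ 2)) (by linarith) #M
    calc _ = N ^ (2 * #M) * (1 + #M * -((#M : ℝ) / N ^ 2)) := by ring
      _ ≤ N ^ (2 * #M) * (1 + -((#M : ℝ) / N ^ 2)) ^ #M := by gcongr
      _ = _ := by
        rw [pow_mul, ← mul_pow]
        congr 1
        field_simp
        ring
  have hA : F / p ^ 2 * (1 - #M * (3 * #Q + 3 * #Q' + 28 / 3 * #M) / N) ≤
      N ^ (2 * #M) * (R / (N ^ 6 * p ^ 2)) := by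
    rw [← sub_nonneg]
    have : N ^ (2 * #M) * (R / (N ^ 6 * p ^ 2)) -
        F / p ^ 2 * (1 - #M * (3 * #Q + 3 * #Q' + 28 / 3 * #M) / N) =
        (3 * (N ^ (2 * #M) * R) + N ^ 5 * F * (#M * (9 * #Q + 9 * #Q' + 28 * #M)) -
          3 * N ^ 6 * F) / (3 * N ^ 6 * p ^ 2) := by
      field_simp
      ring
    rw [this]
    exact div_nonneg (by linarith) (by positivity)
  have hIA : e / P * (F / p ^ 2) * (N ^ 2 - #M) ^ #M ≤ F / p ^ 2 := by
    have : e / P * (N ^ 2 - #M) ^ #M ≤ 1 := by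
      rw [div_mul_eq_mul_div, div_le_one hP]; linarith
    calc _ = (e / P * (N ^ 2 - #M) ^ #M) * (F / p ^ 2) := by ring
      _ ≤ 1 * (F / p ^ 2) := by gcongr
      _ = _ := one_mul _
  generalize (#M : ℝ) * (3 * #Q + 3 * #Q' + 28 / 3 * #M) / N = ε at *
  generalize (#M : ℝ) ^ 2 / N ^ 2 = δ at *
  generalize R / (N ^ 6 * p ^ 2) = r at *
  generalize e / P * (F / p ^ 2) = i at *
  -- The chain below multiplies inequalities by 1 - ε, so a negative factor is treated separately;
  -- there the left side is nonpositive.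
  rcases le_total (1 - ε) 0 with hneg | hpos
  · exact le_trans (mul_nonpos_of_nonpos_of_nonneg (by linarith) hI) hR
  · refine le_of_mul_le_mul_left ?_ (pow_pos hN (2 * #M))
    calc _ ≤ (i * (N ^ (2 * #M) * (1 - δ))) * (1 - ε) := by
          have : 0 ≤ N ^ (2 * #M) * i * (ε * δ) := by positivity
          linarith
      _ ≤ (i * (N ^ 2 - #M) ^ #M) * (1 - ε) := by gcongr
      _ ≤ F / p ^ 2 * (1 - ε) := by gcongr
      _ ≤ _ := hA

/-! ### Clashes in the ideal world -/

/-- The input-output pair that belongs to a query with its answer. -/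
def record {α : Type*} : Dir → α → α → α × α
  | .forward, x, y => (x, y)
  | .backward, x, y => (y, x)

theorem ask_eq_iff {α : Type} (π : Equiv.Perm α) (d : Dir) (x y : α) :
    ask π d x = y ↔ π (record d x y).1 = (record d x y).2 := by
  cases d
  · rfl
  · exact (Equiv.symm_apply_eq π).trans eq_comm

theorem Clash.symm {p p' : Str (n + n) × Str (n + n)} (h : Clash p p') : Clash p' p :=
  h.imp (fun h => ⟨h.1.symm, by rw [add_comm, h.2, add_comm]⟩)
    (fun h => ⟨h.1.symm, by rw [add_comm, h.2, add_comm]⟩)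

theorem card_left_eq_le (z : Str n) : #{y : Str (n + n) | left y = z} ≤ Fintype.card (Str n) := by
  refine card_le_card_of_injOn right (fun _ _ => mem_coe.2 (mem_univ _)) fun x hx y hy h =>
    ext_left_right ?_ h
  rw [(mem_filter.1 (mem_coe.1 hx)).2, (mem_filter.1 (mem_coe.1 hy)).2]

theorem card_right_eq_le (z : Str n) :
    #{y : Str (n + n) | right y = z} ≤ Fintype.card (Str n) := by
  refine card_le_card_of_injOn left (fun _ _ => mem_coe.2 (mem_univ _)) fun x hx y hy h =>
    ext_left_right h ?_
  rw [(mem_filter.1 (mem_coe.1 hx)).2, (mem_filter.1 (mem_coe.1 hy)).2]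

/-- In either direction, each of the two alternatives of `Clash` fixes one half of the answer and
leaves N choices for the other. -/
theorem card_clash_record_le (d : Dir) (x : Str (n + n)) (p : Str (n + n) × Str (n + n)) :
    #{y | Clash (record d x y) p} ≤ 2 * Fintype.card (Str n) := by
  have hc : ∀ {x y z w : Str n}, x + y = z + w → y + w = x + z :=
    add_eq_of_add_eq_add add_self_eq_zero
  rw [two_mul]
  cases d with
  | forward =>
    refine (card_filter_le_add _ _ (fun y => left y = left p.2)
      (fun y => left y = left x + left p.1 + left p.2) fun y hy => ?_).trans
      (add_le_add (card_left_eq_le _) (card_left_eq_le _))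
    refine hy.imp (fun h => h.1) fun h => ?_
    have h2 : left x + left p.1 = left y + left p.2 := h.2
    rw [h2, add_add_cancel_right]
  | backward =>
    refine (card_filter_le_add _ _ (fun y => right y = right x + right p.2 + right p.1)
      (fun y => right y = right p.1) fun y hy => ?_).trans
      (add_le_add (card_right_eq_le _) (card_right_eq_le _))
    refine hy.imp (fun h => ?_) fun h => h.1
    have h2 : right x + right p.2 = right y + right p.1 := h.2
    rw [h2, add_add_cancel_right]

theorem card_not_clashFree_le {M : Finset (Str (n + n) × Str (n + n))} (hM : ClashFree M)
    (d : Dir) (x : Str (n + n)) :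
    #{y | ¬ ClashFree (insert (record d x y) M)} ≤ #M * (2 * Fintype.card (Str n)) := by
  refine le_trans (card_le_card fun y hy => ?_) (card_filter_exists_le univ M
    (fun p y => Clash (record d x y) p) _ fun p _ => card_clash_record_le d x p)
  refine mem_filter.2 ⟨mem_univ _, ?_⟩
  by_contra hno
  push Not at hno
  refine (mem_filter.1 hy).2 fun p hp p' hp' hne h => ?_
  rcases mem_insert.1 hp with rfl | hp <;> rcases mem_insert.1 hp' with rfl | hp'
  · exact hne rfl
  · exact hno _ hp' h
  · exact hno _ hp h.symm
  · exact hM p hp p' hp' hne h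

/-- A repeated query cannot create a clash: the recorded answer leaves `M` unchanged, and any other
answer has no extension. For a new query each answer has probability at most 1/(N² - #M). -/
theorem sum_card_extensions_not_clashFree_le {M : Finset (Str (n + n) × Str (n + n))}
    (hM : ClashFree M) (d : Dir) (x : Str (n + n)) :
    (Fintype.card (Str n) ^ 2 - #M) * ∑ y with ¬ ClashFree (insert (record d x y) M),
      #(extensions (insert (record d x y) M)) ≤
      #M * (2 * Fintype.card (Str n)) * #(extensions M) := by
  have hstep : ∀ y, ¬ ClashFree (insert (record d x y) M) →
      (Fintype.card (Str n) ^ 2 - #M) * #(extensions (insert (record d x y) M)) ≤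
        #(extensions M) := by
    intro y _
    have hmem : ∀ p ∈ M, p = record d x y → insert (record d x y) M = M :=
      fun p hp h => insert_eq_of_mem (h ▸ hp)
    rw [← card_str_add]
    cases d with
    | forward =>
      by_cases hx : ∀ p ∈ M, p.1 ≠ x
      · exact mul_card_extensions_insert_le_of_left hx
      · push Not at hx
        obtain ⟨⟨_, c⟩, hp, rfl⟩ := hx
        rcases eq_or_ne c y with rfl | hcy
        · exact absurd (hmem _ hp rfl ▸ hM) ‹_›
        · rw [record, extensions_insert_eq_empty_of_left hp hcy]; simp
    | backward =>
      by_cases hx : ∀ p ∈ M, p.2 ≠ x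
      · exact mul_card_extensions_insert_le_of_right hx
      · push Not at hx
        obtain ⟨⟨c, _⟩, hp, rfl⟩ := hx
        rcases eq_or_ne c y with rfl | hcy
        · exact absurd (hmem _ hp rfl ▸ hM) ‹_›
        · rw [record, extensions_insert_eq_empty_of_right hp hcy]; simp
  rw [mul_sum]
  refine (sum_le_card_nsmul _ _ _ fun y hy => hstep y (mem_filter.1 hy).2).trans ?_
  rw [smul_eq_mul]
  exact Nat.mul_le_mul_right _ (card_not_clashFree_le hM d x)

theorem sum_prob_ideal_not_clashFree_le {M : Finset (Str (n + n) × Str (n + n))}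
    (hM : ClashFree M) {q : ℕ} (hq : #M ≤ q) (hqN : q < Fintype.card (Str n) ^ 2)
    (Q Q' : Finset (Str n × Str n)) (d : Dir) (x : Str (n + n)) :
    ∑ y with ¬ ClashFree (insert (record d x y) M),
      prob (fun ω : IdealSample n => Consistent (insert (record d x y) M) Q Q' (idealOracles ω)) ≤
      2 * q * Fintype.card (Str n) / (Fintype.card (Str n) ^ 2 - q) *
        prob (fun ω : IdealSample n => Consistent M Q Q' (idealOracles ω)) := by
  have h := sum_card_extensions_not_clashFree_le hM d x
  simp only [prob_ideal_consistent, ← sum_mul, ← sum_div]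
  rw [← mul_assoc]
  refine mul_le_mul_of_nonneg_right ?_ (by positivity)
  rw [← mul_div_assoc]
  refine div_le_div_of_nonneg_right ?_ (by positivity)
  have h' : (Fintype.card (Str n) ^ 2 - q) * ∑ y with ¬ ClashFree (insert (record d x y) M),
      #(extensions (insert (record d x y) M)) ≤
      q * (2 * Fintype.card (Str n)) * #(extensions M) :=
    le_trans (Nat.mul_le_mul_right _ (by omega)) (h.trans (by gcongr))
  rify [hqN.le] at h'
  have hpos : (0 : ℝ) < (Fintype.card (Str n) : ℝ) ^ 2 - q := by
    rw [sub_pos]; exact_mod_cast hqN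
  rw [div_mul_eq_mul_div, le_div_iff₀ hpos]
  linarith

/-! ### Induction over the adversary's decision tree -/

theorem clashFree_empty : ClashFree (∅ : Finset (Str (n + n) × Str (n + n))) :=
  fun _ hp => absurd hp (notMem_empty _)

theorem consistent_empty (O : Oracles n) : Consistent ∅ ∅ ∅ O := by
  simp [Consistent, extensions_empty]

theorem consistent_insert_block {M : Finset (Str (n + n) × Str (n + n))}
    {Q Q' : Finset (Str n × Str n)} {O : Oracles n} {d : Dir} {x y : Str (n + n)} :
    Consistent (insert (record d x y) M) Q Q' O ↔ Consistent M Q Q' O ∧ ask O.block d x = y := by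
  rw [Consistent, Consistent, mem_extensions_insert, ask_eq_iff]
  tauto

theorem consistent_insert_pub₁ {M : Finset (Str (n + n) × Str (n + n))}
    {Q Q' : Finset (Str n × Str n)} {O : Oracles n} {d : Dir} {x y : Str n} :
    Consistent M (insert (record d x y) Q) Q' O ↔ Consistent M Q Q' O ∧ ask O.pub₁ d x = y := by
  rw [Consistent, Consistent, mem_extensions_insert, ask_eq_iff]
  tauto

theorem consistent_insert_pub₂ {M : Finset (Str (n + n) × Str (n + n))}
    {Q Q' : Finset (Str n × Str n)} {O : Oracles n} {d : Dir} {x y : Str n} :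
    Consistent M Q (insert (record d x y) Q') O ↔ Consistent M Q Q' O ∧ ask O.pub₂ d x = y := by
  rw [Consistent, Consistent, mem_extensions_insert, ask_eq_iff]
  tauto

theorem sum_prob_consistent_run {Ω β : Type*} [Fintype Ω] [Fintype β] (O : Ω → Oracles n)
    (E : Oracles n → Prop) (E' : β → Oracles n → Prop) (g : Oracles n → β)
    (hE : ∀ y O, E' y O ↔ E O ∧ g O = y) (A : β → DetAdversary n) (b : Bool) :
    ∑ y, prob (fun ω => E' y (O ω) ∧ (A y).run (O ω) = b) =
      prob (fun ω => E (O ω) ∧ (A (g (O ω))).run (O ω) = b) := by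
  rw [← sum_prob_and_eq (fun ω => E (O ω) ∧ (A (g (O ω))).run (O ω) = b) (fun ω => g (O ω))]
  refine sum_congr rfl fun y _ => congrArg prob (funext fun ω => propext ?_)
  rw [hE]
  constructor
  · rintro ⟨⟨h, rfl⟩, h'⟩; exact ⟨⟨h, h'⟩, rfl⟩
  · rintro ⟨⟨h, h'⟩, rfl⟩; exact ⟨⟨h, rfl⟩, h'⟩

theorem sum_prob_consistent {Ω β : Type*} [Fintype Ω] [Fintype β] (O : Ω → Oracles n)
    (E : Oracles n → Prop) (E' : β → Oracles n → Prop) (g : Oracles n → β)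
    (hE : ∀ y O, E' y O ↔ E O ∧ g O = y) :
    ∑ y, prob (fun ω => E' y (O ω)) = prob (fun ω => E (O ω)) := by
  rw [← sum_prob_and_eq (fun ω => E (O ω)) (fun ω => g (O ω))]
  simp only [hE]

/-- Conditioning on the answer splits every probability into a sum over the children of a node. The
error ε is paid at the leaves, and c once per block query for leaving the clash-free transcripts. -/
theorem prob_consistent_run_le {q q₁ q₂ : ℕ} {ε c : ℝ} (hε : 0 ≤ ε) (hc : 0 ≤ c)
    (hleaf : ∀ (M : Finset (Str (n + n) × Str (n + n))) (Q Q' : Finset (Str n × Str n)),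
      #M ≤ q → #Q ≤ q₁ → #Q' ≤ q₂ → ClashFree M →
      prob (fun ω : IdealSample n => Consistent M Q Q' (idealOracles ω)) ≤
        prob (fun ω : RealSample n => Consistent M Q Q' (realOracles ω)) +
        ε * prob (fun ω : IdealSample n => Consistent M Q Q' (idealOracles ω)))
    (hstep : ∀ (M : Finset (Str (n + n) × Str (n + n))) (Q Q' : Finset (Str n × Str n))
      (d : Dir) (x : Str (n + n)), #M ≤ q → ClashFree M →
      ∑ y with ¬ ClashFree (insert (record d x y) M),
        prob (fun ω : IdealSample n =>
          Consistent (insert (record d x y) M) Q Q' (idealOracles ω)) ≤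
        c * prob (fun ω : IdealSample n => Consistent M Q Q' (idealOracles ω)))
    (b : Bool) (A : DetAdversary n) : ∀ (k k₁ k₂ : ℕ) (M : Finset (Str (n + n) × Str (n + n)))
      (Q Q' : Finset (Str n × Str n)), A.MakesAtMost k k₁ k₂ →
      #M + k ≤ q → #Q + k₁ ≤ q₁ → #Q' + k₂ ≤ q₂ → ClashFree M →
      prob (fun ω : IdealSample n => Consistent M Q Q' (idealOracles ω) ∧
          A.run (idealOracles ω) = b) ≤
        prob (fun ω : RealSample n => Consistent M Q Q' (realOracles ω) ∧
          A.run (realOracles ω) = b) +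
        (ε + k * c) * prob (fun ω : IdealSample n => Consistent M Q Q' (idealOracles ω)) := by
  induction A with
  | output b' =>
    intro k k₁ k₂ M Q Q' _ hM hQ hQ' hfree
    have hI := prob_nonneg (fun ω : IdealSample n => Consistent M Q Q' (idealOracles ω))
    simp only [DetAdversary.run]
    by_cases hb : b' = b
    · simp only [hb, and_true]
      refine (hleaf M Q Q' (by omega) (by omega) (by omega) hfree).trans ?_
      have : 0 ≤ k * c * prob (fun ω : IdealSample n => Consistent M Q Q' (idealOracles ω)) := by
        positivity
      linarith
    · simp only [hb, and_false]
      have h0 : prob (fun _ : IdealSample n => False) = 0 := by simp [prob]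
      rw [h0]
      have := prob_nonneg (fun _ : RealSample n => False)
      positivity
  | queryBlock d x next ih =>
    intro k k₁ k₂ M Q Q' hA hM hQ hQ' hfree
    obtain ⟨hk, hA⟩ := hA
    have hE : ∀ y (O : Oracles n), Consistent (insert (record d x y) M) Q Q' O ↔
        Consistent M Q Q' O ∧ ask O.block d x = y := fun y O => consistent_insert_block
    simp only [DetAdversary.run]
    rw [← sum_prob_consistent_run idealOracles _ _ _ hE next b,
      ← sum_prob_consistent_run realOracles _ _ _ hE next b]
    have hsum := sum_prob_consistent (Ω := IdealSample n) idealOracles _ _ _ hE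
    have hbad := hstep M Q Q' d x (by omega) hfree
    obtain ⟨k, rfl⟩ : ∃ j, k = j + 1 := ⟨k - 1, by omega⟩
    have hy : ∀ y, prob (fun ω : IdealSample n =>
        Consistent (insert (record d x y) M) Q Q' (idealOracles ω) ∧
          (next y).run (idealOracles ω) = b) ≤
        prob (fun ω : RealSample n => Consistent (insert (record d x y) M) Q Q' (realOracles ω) ∧
          (next y).run (realOracles ω) = b) +
        (ε + k * c) * prob (fun ω : IdealSample n =>
          Consistent (insert (record d x y) M) Q Q' (idealOracles ω)) +
        if ¬ ClashFree (insert (record d x y) M) then prob (fun ω : IdealSample n =>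
          Consistent (insert (record d x y) M) Q Q' (idealOracles ω)) else 0 := by
      intro y
      have hle := card_insert_le (record d x y) M
      by_cases hf : ClashFree (insert (record d x y) M)
      · rw [if_neg (not_not_intro hf), add_zero]
        exact ih y k k₁ k₂ _ Q Q' (hA y) (by omega) hQ hQ' hf
      · rw [if_pos hf]
        have h1 := prob_nonneg (fun ω : RealSample n =>
          Consistent (insert (record d x y) M) Q Q' (realOracles ω) ∧
          (next y).run (realOracles ω) = b)
        have h2 := prob_nonneg (fun ω : IdealSample n =>
          Consistent (insert (record d x y) M) Q Q' (idealOracles ω))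
        -- After a clash nothing is compared: the whole ideal mass of the branch is charged to
        -- `hstep`.
        refine (prob_mono fun ω h => h.1).trans (le_add_of_nonneg_left
          (add_nonneg h1 (mul_nonneg (add_nonneg hε (mul_nonneg k.cast_nonneg hc)) h2)))
    refine (sum_le_sum fun y _ => hy y).trans ?_
    rw [sum_add_distrib, sum_add_distrib, ← mul_sum, hsum, ← sum_filter]
    push_cast
    linarith
  | queryPub₁ d x next ih =>
    intro k k₁ k₂ M Q Q' hA hM hQ hQ' hfree
    obtain ⟨hk, hA⟩ := hA
    have hE : ∀ y (O : Oracles n), Consistent M (insert (record d x y) Q) Q' O ↔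
        Consistent M Q Q' O ∧ ask O.pub₁ d x = y := fun y O => consistent_insert_pub₁
    simp only [DetAdversary.run]
    rw [← sum_prob_consistent_run idealOracles _ _ _ hE next b,
      ← sum_prob_consistent_run realOracles _ _ _ hE next b,
      ← sum_prob_consistent (Ω := IdealSample n) idealOracles _ _ _ hE, mul_sum,
      ← sum_add_distrib]
    refine sum_le_sum fun y _ => ?_
    have hle := card_insert_le (record d x y) Q
    exact ih y k (k₁ - 1) k₂ M _ Q' (hA y) hM (by omega) hQ' hfree
  | queryPub₂ d x next ih =>
    intro k k₁ k₂ M Q Q' hA hM hQ hQ' hfree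
    obtain ⟨hk, hA⟩ := hA
    have hE : ∀ y (O : Oracles n), Consistent M Q (insert (record d x y) Q') O ↔
        Consistent M Q Q' O ∧ ask O.pub₂ d x = y := fun y O => consistent_insert_pub₂
    simp only [DetAdversary.run]
    rw [← sum_prob_consistent_run idealOracles _ _ _ hE next b,
      ← sum_prob_consistent_run realOracles _ _ _ hE next b,
      ← sum_prob_consistent (Ω := IdealSample n) idealOracles _ _ _ hE, mul_sum,
      ← sum_add_distrib]
    refine sum_le_sum fun y _ => ?_
    have hle := card_insert_le (record d x y) Q'
    exact ih y k k₁ (k₂ - 1) M Q _ (hA y) hM hQ (by omega) hfree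

/-! ### Numerical constants -/

theorem card_str : Fintype.card (Str n) = 2 ^ n := by
  simp only [Fintype.card_fun, ZMod.card, Fintype.card_fin]

theorem prob_ideal_run_le {q q₁ q₂ : ℕ} (h : q * (13 * q + 4 * q₁ + 4 * q₂) < 2 ^ n)
    (b : Bool) {A : DetAdversary n} (hA : A.MakesAtMost q q₁ q₂) :
    prob (fun ω : IdealSample n => A.run (idealOracles ω) = b) ≤
      prob (fun ω : RealSample n => A.run (realOracles ω) = b) +
      (q : ℝ) * (13 * q + 4 * q₁ + 4 * q₂) / 2 ^ n := by
  rw [← card_str (n := n)] at h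
  have hcast : (Fintype.card (Str n) : ℝ) = 2 ^ n := by rw [card_str]; norm_cast
  rw [← hcast]
  have hN : 1 ≤ Fintype.card (Str n) := Fintype.card_pos
  have hqN : 13 * q ≤ Fintype.card (Str n) := by
    rcases Nat.eq_zero_or_pos q with rfl | hq
    · simp
    · refine le_trans ?_ h.le
      nlinarith [Nat.zero_le (q * q₁), Nat.zero_le (q * q₂)]
  have hqN2 : q < Fintype.card (Str n) ^ 2 := by
    rw [sq]; nlinarith
  -- With at least one block query, N > 13q + 4q₁ + 4q₂, which leaves room for 4(r + 1).
  have hbig : ∀ (r : ℕ) (_ : r ≤ q₁ ∨ r ≤ q₂) (m : ℕ), 1 ≤ m → m ≤ q →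
      4 * (r + 1) ≤ Fintype.card (Str n) := by
    intro r hr m hm hmq
    have : 13 * q + 4 * q₁ + 4 * q₂ ≤ q * (13 * q + 4 * q₁ + 4 * q₂) :=
      Nat.le_mul_of_pos_left _ (by omega)
    omega
  set N := Fintype.card (Str n) with hNdef
  have hN' : (1 : ℝ) ≤ N := by exact_mod_cast hN
  have hqN' : 13 * (q : ℝ) ≤ N := by exact_mod_cast hqN
  have hden : 12 / 13 * (N : ℝ) ^ 2 ≤ (N : ℝ) ^ 2 - q := by nlinarith
  have hden0 : (0 : ℝ) < (N : ℝ) ^ 2 - q := lt_of_lt_of_le (by positivity) hden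
  have key := prob_consistent_run_le (n := n) (q := q) (q₁ := q₁) (q₂ := q₂)
    (ε := (q : ℝ) * (3 * q₁ + 3 * q₂ + 28 / 3 * q) / N + (q : ℝ) ^ 2 / (N : ℝ) ^ 2)
    (c := 2 * q * N / ((N : ℝ) ^ 2 - q)) (by positivity) (by positivity)
    (fun M Q Q' hM hQ hQ' hfree => ?_)
    (fun M Q Q' d x hM hfree => sum_prob_ideal_not_clashFree_le hfree hM hqN2 Q Q' d x)
    b A q q₁ q₂ ∅ ∅ ∅ hA (by simp) (by simp) (by simp) clashFree_empty
  · simp only [consistent_empty, true_and] at key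
    have h1 : prob (fun _ : IdealSample n => True) ≤ 1 := by
      rw [prob]
      refine div_le_one_of_le₀ ?_ (by positivity)
      exact_mod_cast card_le_univ _
    -- Here 13/6 = 2 · 13/12, the factor 13/12 coming from `hden`.
    have hc : (q : ℝ) * (2 * q * N / ((N : ℝ) ^ 2 - q)) ≤ 13 / 6 * q ^ 2 / N := by
      rw [← mul_div_assoc, div_le_div_iff₀ hden0 (by positivity)]
      have := mul_le_mul_of_nonneg_left hden (by positivity : (0 : ℝ) ≤ 13 / 6 * (q : ℝ) ^ 2)
      linarith
    have hsq : (q : ℝ) ^ 2 / (N : ℝ) ^ 2 ≤ (q : ℝ) ^ 2 / N := by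
      gcongr
      nlinarith
    have htot : (q : ℝ) * (3 * q₁ + 3 * q₂ + 28 / 3 * q) / N + (q : ℝ) ^ 2 / (N : ℝ) ^ 2 +
        q * (2 * q * N / ((N : ℝ) ^ 2 - q)) ≤ (q : ℝ) * (13 * q + 4 * q₁ + 4 * q₂) / N := by
      calc _ ≤ (q : ℝ) * (3 * q₁ + 3 * q₂ + 28 / 3 * q) / N + (q : ℝ) ^ 2 / N +
            13 / 6 * q ^ 2 / N := by gcongr
        _ = ((q : ℝ) * (3 * q₁ + 3 * q₂ + 28 / 3 * q) + (q : ℝ) ^ 2 + 13 / 6 * q ^ 2) / N := by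
          ring
        -- The coefficient of q² is 28/3 + 1 + 13/6 = 25/2 ≤ 13; those of q·q₁ and q·q₂ are 3 ≤ 4.
        _ ≤ _ := by
          gcongr
          have : (0 : ℝ) ≤ q * q₁ := by positivity
          have : (0 : ℝ) ≤ q * q₂ := by positivity
          nlinarith [sq_nonneg (q : ℝ)]
    refine key.trans (add_le_add_right ((mul_le_of_le_one_right (by positivity) h1).trans htot) _)
  · have hle := prob_ideal_consistent_le (Q := Q) (Q' := Q') hfree (hM.trans hqN2.le)
      (fun hne => hbig _ (.inl hQ) _ hne.card_pos hM)
      (fun hne => hbig _ (.inr hQ') _ hne.card_pos hM)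
    have hI := prob_nonneg (fun ω : IdealSample n => Consistent M Q Q' (idealOracles ω))
    have hmono : (#M * (3 * #Q + 3 * #Q' + 28 / 3 * #M) / N + #M ^ 2 / (N : ℝ) ^ 2 : ℝ) ≤
        (q : ℝ) * (3 * q₁ + 3 * q₂ + 28 / 3 * q) / N + (q : ℝ) ^ 2 / (N : ℝ) ^ 2 := by
      gcongr
    have := mul_le_mul_of_nonneg_right hmono hI
    linarith

end Classical

/-! ### From counting to distributions and randomized adversaries -/

variable {n : ℕ}

theorem bind_uniformOfFintype_prod {α β γ : Type*} [Fintype α] [Nonempty α] [Fintype β] [Nonempty β]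
    (F : α → β → PMF γ) :
    ((PMF.uniformOfFintype α).bind fun a => (PMF.uniformOfFintype β).bind fun b => F a b) =
      (PMF.uniformOfFintype (α × β)).bind fun x => F x.1 x.2 := by
  ext c
  simp only [PMF.bind_apply, tsum_fintype, PMF.uniformOfFintype_apply, Fintype.sum_prod_type,
    Fintype.card_prod, Finset.mul_sum, Nat.cast_mul]
  refine Finset.sum_congr rfl fun a _ => Finset.sum_congr rfl fun b _ => ?_
  rw [ENNReal.mul_inv (.inr (ENNReal.natCast_ne_top _)) (.inl (ENNReal.natCast_ne_top _)),
    mul_assoc]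

theorem realWorld_eq (n : ℕ) :
    realWorld n =
      (PMF.uniformOfFintype (RealSample n)).bind fun ω => PMF.pure (realOracles ω) := by
  simp only [realWorld, bind_uniformOfFintype_prod]
  rfl

theorem idealWorld_eq (n : ℕ) :
    idealWorld n =
      (PMF.uniformOfFintype (IdealSample n)).bind fun ω => PMF.pure (idealOracles ω) := by
  simp only [idealWorld, bind_uniformOfFintype_prod]
  rfl

/-- The probability that a deterministic adversary outputs `b`, for uniformly sampled oracles. -/
theorem bind_run_apply {Ω : Type} [Fintype Ω] [Nonempty Ω] (O : Ω → Oracles n)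
    (A : DetAdversary n) (b : Bool) :
    (((PMF.uniformOfFintype Ω).bind fun ω => PMF.pure (O ω)).bind
      fun O => PMF.pure (A.run O)) b = ENNReal.ofReal (prob fun ω => A.run (O ω) = b) := by
  classical
  rw [PMF.bind_bind]
  simp only [PMF.pure_bind, PMF.bind_apply, PMF.pure_apply, tsum_fintype,
    PMF.uniformOfFintype_apply, mul_ite, mul_one, mul_zero]
  rw [← Finset.sum_filter, Finset.sum_const, nsmul_eq_mul, prob,
    ENNReal.ofReal_div_of_pos (by exact_mod_cast Fintype.card_pos), ENNReal.ofReal_natCast,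
    ENNReal.ofReal_natCast, div_eq_mul_inv]
  congr! 4 with ω
  exact eq_comm

theorem prob_run_false {Ω : Type} [Fintype Ω] [Nonempty Ω] (O : Ω → Oracles n)
    (A : DetAdversary n) :
    prob (fun ω => A.run (O ω) = false) = 1 - prob (fun ω => A.run (O ω) = true) := by
  rw [eq_sub_iff_add_eq, prob, prob, ← add_div, div_eq_one_iff_eq
    (by exact_mod_cast Fintype.card_ne_zero), ← Nat.cast_add, Nat.cast_inj, add_comm]
  have h := Finset.card_filter_add_card_filter_not (s := Finset.univ)
    (fun ω => A.run (O ω) = true)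
  simp only [Bool.not_eq_true, Finset.card_univ] at h
  convert h

theorem outputDist_le {A : Adversary n} {W W' : PMF (Oracles n)} {δ : ENNReal} {b : Bool}
    (h : ∀ D ∈ A.support, (W.bind fun O => PMF.pure (D.run O)) b ≤
      (W'.bind fun O => PMF.pure (D.run O)) b + δ) :
    outputDist A W b ≤ outputDist A W' b + δ := by
  rw [outputDist, outputDist, PMF.bind_apply, PMF.bind_apply]
  calc _ ≤ ∑' D, (A D * (W'.bind fun O => PMF.pure (D.run O)) b + A D * δ) := by
        refine ENNReal.tsum_le_tsum fun D => ?_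
        by_cases hD : A D = 0
        · simp [hD]
        · rw [← mul_add]
          exact mul_le_mul_right (h D ((PMF.mem_support_iff _ _).2 hD)) _
    _ = _ := by rw [ENNReal.tsum_add, ENNReal.tsum_mul_right, A.tsum_coe, one_mul]

theorem probOne_le {A : Adversary n} {W W' : PMF (Oracles n)} {δ : ℝ} (hδ : 0 ≤ δ)
    (h : ∀ D ∈ A.support, (W.bind fun O => PMF.pure (D.run O)) true ≤
      (W'.bind fun O => PMF.pure (D.run O)) true + ENNReal.ofReal δ) :
    probOne A W ≤ probOne A W' + δ := by
  have := ENNReal.toReal_mono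
    (ENNReal.add_ne_top.2 ⟨PMF.apply_ne_top _ _, ENNReal.ofReal_ne_top⟩) (outputDist_le h)
  rwa [ENNReal.toReal_add (PMF.apply_ne_top _ _) ENNReal.ofReal_ne_top,
    ENNReal.toReal_ofReal hδ] at this

theorem advantage_le {q q₁ q₂ : ℕ} {A : Adversary n} (hA : A.MakesAtMost q q₁ q₂) :
    advantage A (realWorld n) (idealWorld n) ≤
      (q : ℝ) * (13 * q + 4 * q₁ + 4 * q₂) / 2 ^ n := by
  have hδ : 0 ≤ (q : ℝ) * (13 * q + 4 * q₁ + 4 * q₂) / 2 ^ n := by positivity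
  by_cases h : q * (13 * q + 4 * q₁ + 4 * q₂) < 2 ^ n
  · rw [advantage, abs_sub_le_iff, realWorld_eq, idealWorld_eq]
    constructor <;> rw [sub_le_iff_le_add'] <;> refine probOne_le hδ fun D hD => ?_ <;>
      rw [bind_run_apply, bind_run_apply, ← ENNReal.ofReal_add (prob_nonneg _) hδ] <;>
      refine ENNReal.ofReal_le_ofReal ?_
    -- The one-sided bound for output 0 is the reverse inequality for output 1.
    · have := prob_ideal_run_le h false (hA D hD)
      rw [prob_run_false, prob_run_false] at this
      linarith
    · exact prob_ideal_run_le h true (hA D hD)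
  -- Otherwise the claimed bound is at least 1, hence trivial.
  · have h1 : 1 ≤ (q : ℝ) * (13 * q + 4 * q₁ + 4 * q₂) / 2 ^ n := by
      rw [one_le_div (by positivity)]
      exact_mod_cast not_lt.1 h
    have h2 := probOne_mem A (realWorld n)
    have h3 := probOne_mem A (idealWorld n)
    exact (abs_le.2 ⟨by linarith [h2.1, h3.2], by linarith [h2.2, h3.1]⟩).trans h1

end BPEM

theorem mainTheorem1 (n : ℕ) (hn : 1 ≤ n) (q q₁ q₂ : ℕ) :
    BPEM.imSprpAdvantage n q q₁ q₂ ≤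
      ((q : ℝ) * (13 * (q : ℝ) + 4 * (q₁ : ℝ) + 4 * (q₂ : ℝ))) / (2 : ℝ) ^ n := by
  refine csSup_le (BPEM.advantages_nonempty _ _ _ _ _) ?_
  rintro _ ⟨A, hA, rfl⟩
  exact BPEM.advantage_le hA
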